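/- Let $d,T\in\mathbb N$ and regard $\mathbb R^{dT}$ as the space of paths $x=(x_1,\dots,x_T)$, $x_t\in\mathbb R^d$, with the Euclidean norm $|\cdot|$. For probability measures $\mu,\nu$ on $\mathbb R^{dT}$, a coupling $\pi$ of $\mu$ and $\nu$ is called bi-causal if, for all $t=1,\dots,T-1$ and almost all $(x_{1:t},y_{1:t})$, the conditional law under $\pi$ of $(x_{t+1:T},y_{t+1:T})$ given $(x_{1:t},y_{1:t})$ is a coupling of the conditional law under $\mu$ of $x_{t+1:T}$ given $x_{1:t}$ and the conditional law under $\nu$ of $y_{t+1:T}$ given $y_{1:t}$. For $\lambda\ge 0$ let $$\mathcal{AW}_{2,\lambda}^2(\mu,\nu)=\inf_{\pi}\Big\{\int|x-y|^2\,d\pi+\lambda\,\mathcal D_{\mathrm{KL}}(\pi\,|\,\mu\otimes\nu)\Big\},$$ the infimum running over all bi-causal couplings $\pi$ of $\mu$ and $\nu$ (with $0\cdot\infty=0$); a bi-causal coupling attaining it is called an optimizer. Let $\mu=\mathcal N(a,A)$ and $\nu=\mathcal N(b,B)$ be Gaussian distributions on $\mathbb R^{dT}$ with positive definite covariance matrices,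 and let $A=LL^\top$, $B=MM^\top$ be their Cholesky decompositions ($L,M$ lower triangular with positive diagonal). For $t=1,\dots,T$ let $U_tS_tV_t^\top$ be a singular value decomposition of the $t$-th diagonal $d\times d$ block $(M^\top L)_{t,t}$ ($U_t,V_t$ orthogonal, $S_t$ diagonal with non-negative entries), and let $S=\mathrm{diag}(S_1,\dots,S_T)$. For a block diagonal matrix $P=\mathrm{diag}(P_1,\dots,P_T)$ whose blocks $P_t\in\mathbb R^{d\times d}$ are contractions (spectral norm at most $1$) let $$\pi_P=\mathcal N\left(\begin{bmatrix}a\\ b\end{bmatrix},\begin{bmatrix}LL^\top& LPM^\top\\ MP^\top L^\top& MM^\top\end{bmatrix}\right).$$ For $\lambda>0$ put $f_\lambda(0)=0$ and $f_\lambda(x)=\mathrm{sign}(x)\Big(\sqrt{\big(\tfrac{\lambda}{4|x|}\big)^2+1}-\tfrac{\lambda}{4|x|}\Big)$ for $x\ne 0$, and let $(D_\lambda)_t$ be the diagonal matrix with diagonal entries $f_\lambda((S_t)_{ii})$. **(i)** If $\lambda>0$ and $P_t=V_t(D_\lambda)_tU_t^\top$ for $t=1,\dots,T$, then $\pi_P$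 is the unique optimizer of $\mathcal{AW}_{2,\lambda}(\mu,\nu)$ (among all bi-causal couplings, Gaussian or not). **(ii)** Let $\lambda=0$. If $P_t=V_tD_tU_t^\top$, where $D_t\in\mathbb R^{d\times d}$ is a contraction with $(D_t)_{ii}=1$ whenever $(S_t)_{ii}\neq0$ ($i=1,\dots,d$, $t=1,\dots,T$), then $\pi_P$ is an optimizer of $\mathcal{AW}_{2,0}(\mu,\nu)$. Conversely, every Gaussian optimizer is of the form $\pi_P$ for such a $P$. Moreover, any such $\pi_P$ is the unique optimizer (among all bi-causal couplings) if and only if $S$ is invertible. -/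

import Mathlib

open MeasureTheory ProbabilityTheory
open scoped ENNReal

namespace AdaptedOT

/-- Paths `x = (x_1, …, x_T)` with `x_t ∈ ℝᵈ`, that is `ℝ^{dT}` with the Euclidean norm.
The coordinate `(t, i)` is the `i`-th coordinate of `x_t` (times are counted from `0`). -/
abbrev Path (T d : ℕ) : Type := EuclideanSpace ℝ (Fin T × Fin d)

/-- `dT × dT` matrices, with their block structure visible in the index type. -/
abbrev BigMatrix (T d : ℕ) : Type := Matrix (Fin T × Fin d) (Fin T × Fin d) ℝ

/-- The first `t` time steps `x_{1:t}` of a path. -/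
def past {T d : ℕ} (t : ℕ) (x : Path T d) : {s : Fin T // s.val < t} × Fin d → ℝ :=
  fun p => x (p.1.val, p.2)

/-- The time steps `x_{t+1:T}` of a path. -/
def future {T d : ℕ} (t : ℕ) (x : Path T d) : {s : Fin T // t ≤ s.val} × Fin d → ℝ :=
  fun p => x (p.1.val, p.2)

/-- The set of bi-causal couplings of `μ` and `ν`: couplings `π` such that for `t = 1, …, T - 1`
the conditional law under `π` of the pair of futures given both pasts `(x_{1:t}, y_{1:t})` is,
for almost all pasts, a coupling of the conditional law under `μ` of the future given `x_{1:t}`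
and the conditional law under `ν` of the future given `y_{1:t}`. -/
def bicausalCouplings {T d : ℕ} (μ ν : ProbabilityMeasure (Path T d)) :
    Set (ProbabilityMeasure (Path T d × Path T d)) :=
  {π | (π : Measure (Path T d × Path T d)).fst = μ ∧
    (π : Measure (Path T d × Path T d)).snd = ν ∧
    ∀ t : ℕ, 1 ≤ t → t < T →
      ∀ᵐ h ∂((π : Measure (Path T d × Path T d)).map (fun z => (past t z.1, past t z.2))),
        (condDistrib (fun z : Path T d × Path T d => (future t z.1, future t z.2))
            (fun z => (past t z.1, past t z.2)) π h).fst
          = condDistrib (future t) (past t) (μ : Measure (Path T d)) h.1 ∧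
        (condDistrib (fun z : Path T d × Path T d => (future t z.1, future t z.2))
            (fun z => (past t z.1, past t z.2)) π h).snd
          = condDistrib (future t) (past t) (ν : Measure (Path T d)) h.2}

/-- The entropic transport cost `∫ |x - y|² dπ + lam * KL(π | μ ⊗ ν)`, with values in `[0, ∞]`
(where `0 * ∞ = 0`). -/
noncomputable def entropicCost {T d : ℕ} (lam : ℝ) (μ ν : ProbabilityMeasure (Path T d))
    (π : ProbabilityMeasure (Path T d × Path T d)) : ℝ≥0∞ :=
  (∫⁻ z, ENNReal.ofReal (‖z.1 - z.2‖ ^ 2) ∂(π : Measure (Path T d × Path T d))) +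
    ENNReal.ofReal lam *
      InformationTheory.klDiv (π : Measure (Path T d × Path T d))
        ((μ : Measure (Path T d)).prod (ν : Measure (Path T d)))

/-- The squared entropic adapted 2-Wasserstein distance. -/
noncomputable def adaptedWassersteinSq {T d : ℕ} (lam : ℝ)
    (μ ν : ProbabilityMeasure (Path T d)) : ℝ≥0∞ :=
  ⨅ π ∈ bicausalCouplings μ ν, entropicCost lam μ ν π

/-- `π` is an optimizer of the entropic adapted 2-Wasserstein problem between `μ` and `ν`. -/
def IsOptimizer {T d : ℕ} (lam : ℝ) (μ ν : ProbabilityMeasure (Path T d))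
    (π : ProbabilityMeasure (Path T d × Path T d)) : Prop :=
  π ∈ bicausalCouplings μ ν ∧ entropicCost lam μ ν π = adaptedWassersteinSq lam μ ν

/-- `π` is the unique optimizer among all bi-causal couplings, Gaussian or not. -/
def IsUniqueOptimizer {T d : ℕ} (lam : ℝ) (μ ν : ProbabilityMeasure (Path T d))
    (π : ProbabilityMeasure (Path T d × Path T d)) : Prop :=
  IsOptimizer lam μ ν π ∧ ∀ ρ, IsOptimizer lam μ ν ρ → ρ = π

/-- `A = L Lᵀ` is the Cholesky decomposition of `A`: the matrix `L` is lower triangular (for the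
lexicographic order of the coordinates `(t, i)`) with positive diagonal entries. -/
structure IsCholesky {T d : ℕ} (A L : BigMatrix T d) : Prop where
  eq_mul_transpose : A = L * L.transpose
  lower : ∀ s t : Fin T, ∀ i j : Fin d, (s < t ∨ (s = t ∧ i < j)) → L (s, i) (t, j) = 0
  diag_pos : ∀ p, 0 < L p p

/-- The `d × d` block `N_{s,t}` of a `dT × dT` matrix. -/
def block {T d : ℕ} (N : BigMatrix T d) (s t : Fin T) : Matrix (Fin d) (Fin d) ℝ :=
  Matrix.of fun i j => N (s, i) (t, j)

/-- The block diagonal matrix `diag(P_1, …, P_T)`. -/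
def blockDiag {T d : ℕ} (P : Fin T → Matrix (Fin d) (Fin d) ℝ) : BigMatrix T d :=
  Matrix.of fun p q => if p.1 = q.1 then P p.1 p.2 q.2 else 0

/-- A contraction: spectral norm at most one. -/
def IsContraction {d : ℕ} (D : Matrix (Fin d) (Fin d) ℝ) : Prop :=
  ‖Matrix.toEuclideanCLM (𝕜 := ℝ) D‖ ≤ 1

/-- The Gaussian law `N(a, A)` on path space. -/
noncomputable def gaussian {T d : ℕ} (a : Path T d) (A : BigMatrix T d) :
    ProbabilityMeasure (Path T d) :=
  ⟨multivariateGaussian a A, inferInstance⟩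

/-- The splitting of a vector of `ℝ^{dT + dT}` into a pair of paths. -/
def splitPair {T d : ℕ}
    (z : EuclideanSpace ℝ ((Fin T × Fin d) ⊕ (Fin T × Fin d))) : Path T d × Path T d :=
  (WithLp.toLp 2 fun p => z (Sum.inl p), WithLp.toLp 2 fun p => z (Sum.inr p))

theorem measurable_splitPair {T d : ℕ} : Measurable (splitPair (T := T) (d := d)) := by
  unfold splitPair
  fun_prop

/-- The Gaussian law `π_P` with mean `(a, b)` and covariance
`[[L Lᵀ, L P Mᵀ], [M Pᵀ Lᵀ, M Mᵀ]]`, where `P = diag(P_1, …, P_T)`. -/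
noncomputable def gaussianCoupling {T d : ℕ} (a b : Path T d) (L M : BigMatrix T d)
    (P : Fin T → Matrix (Fin d) (Fin d) ℝ) : ProbabilityMeasure (Path T d × Path T d) :=
  ⟨(multivariateGaussian (WithLp.toLp 2 (Sum.elim (fun p => a p) (fun p => b p)))
      (Matrix.fromBlocks (L * L.transpose) (L * blockDiag P * M.transpose)
        (M * (blockDiag P).transpose * L.transpose) (M * M.transpose))).map splitPair,
    Measure.isProbabilityMeasure_map measurable_splitPair.aemeasurable⟩

/-- `N = U diag(s) Vᵀ` is a singular value decomposition of `N`. -/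
structure IsSVD {d : ℕ} (N U : Matrix (Fin d) (Fin d) ℝ) (s : Fin d → ℝ)
    (V : Matrix (Fin d) (Fin d) ℝ) : Prop where
  left_orthogonal : U ∈ Matrix.orthogonalGroup (Fin d) ℝ
  right_orthogonal : V ∈ Matrix.orthogonalGroup (Fin d) ℝ
  nonneg : ∀ i, 0 ≤ s i
  eq_mul : N = U * Matrix.diagonal s * V.transpose

/-- The function `f_lam`. -/
noncomputable def shrink (lam x : ℝ) : ℝ :=
  if x = 0 then 0
  else Real.sign x * (Real.sqrt ((lam / (4 * |x|)) ^ 2 + 1) - lam / (4 * |x|))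

end AdaptedOT

/-!
The proof works in whitened coordinates `u = L⁻¹ (x - a)` and `v = M⁻¹ (y - b)`. Replacing the
Cholesky factors `L`, `M` by `L diag(V_t)`, `M diag(U_t)` leaves the marginals unchanged, keeps the
factors block lower triangular in time, conjugates the blocks of `P`, and makes the diagonal blocks
of `Mᵀ L` diagonal, with entries `s t i` (`areDiagonalizingFactors_mul_blockDiag`,
`gaussianCoupling_mul_blockDiag`). So the singular vectors may be ignored.

As the factors are triangular, `u` and `v` are the normalized innovations of the two processes, and
a coupling is bi-causal exactly when at each time the future of `u`, and likewise that of `v`, is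
independent of the joint past (`mem_bicausalCouplings_iff`). This is where conditional laws are
eliminated: the conditional law of the future given the past is the image of the law of the future
innovations (`condDistrib_ae_eq_comap_iff_indepFun`). Consequently the covariance of `u` and `v`
under a bi-causal coupling is block diagonal (`crossCov_eq_zero_of_ne`), with contractions as
blocks, and conversely each `π_P` is bi-causal (`gaussianCoupling_mem_bicausalCouplings`). The
quadratic cost therefore equals a constant minus `2 ∑ s t i · cov(u_{t,i}, v_{t,i})`
(`integral_norm_sub_sq`).

For `lam > 0` let `π*` be the candidate, whose whitened coordinates have correlations
`r = shrink lam s`. It has a density with respect to `μ ⊗ ν` proportional to the exponential of a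
quadratic form in `u` and `v` (`gaussianCoupling_eq_tilted`) whose mixed terms are
`r / (1 - r²) · u v`. As `lam r / (1 - r²) = 2 s`, these cancel the quadratic cost, while the
squares have the same integral under all couplings. Hence the cost of any bi-causal `π` of
finite cost is a constant plus `lam` times the relative entropy of `π` with respect to `π*`
(`AreDiagonalizingFactors.exists_entropicCost_eq`), which gives existence and uniqueness at
once.

For `lam = 0` all correlations are at most one, so the optimizers are the bi-causal couplings for
which the correlation is one wherever `s t i ≠ 0` (`AreDiagonalizingFactors.isOptimizer_zero_iff`).
If `S` is invertible this forces `u = v` almost surely and determines the coupling; if some `s t i`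
vanishes, the corresponding correlation may be changed. A Gaussian bi-causal coupling is determined
by the blocks of the covariance of `u` and `v`, hence of the form `π_P`
(`AreDiagonalizingFactors.eq_gaussianCoupling`).
-/

namespace AdaptedOT

/-! ### Block matrices and contractions -/

section LinearAlgebra

variable {T d : ℕ}

/-- Block lower triangular matrices with respect to time: the entries with row time strictly
before column time vanish. No condition is put on the diagonal `d × d` blocks. -/
def TimeLower (K : BigMatrix T d) : Prop := ∀ p q, p.1 < q.1 → K p q = 0

theorem TimeLower.inv {K : BigMatrix T d} (hK : TimeLower K) (hdet : IsUnit K.det) :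
    TimeLower K⁻¹ := by
  have h : Matrix.BlockTriangular K (fun p => OrderDual.toDual p.1) := fun p q hpq => hK p q hpq
  let _ := Matrix.invertibleOfIsUnitDet K hdet
  exact fun p q hpq => Matrix.blockTriangular_inv_of_blockTriangular h hpq

theorem TimeLower.mul_blockDiag {K : BigMatrix T d} (hK : TimeLower K)
    (P : Fin T → Matrix (Fin d) (Fin d) ℝ) : TimeLower (K * blockDiag P) := by
  intro p q hpq
  rw [Matrix.mul_apply]
  refine Finset.sum_eq_zero fun r _ => ?_
  by_cases h : r.1 = q.1
  · rw [hK p r (h ▸ hpq), zero_mul]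
  · simp [blockDiag, h]

theorem blockDiag_mul (P Q : Fin T → Matrix (Fin d) (Fin d) ℝ) :
    blockDiag P * blockDiag Q = blockDiag fun t => P t * Q t := by
  ext p q
  rw [Matrix.mul_apply, Fintype.sum_prod_type, Finset.sum_eq_single p.1]
  · by_cases h : p.1 = q.1 <;> simp [blockDiag, h, Matrix.mul_apply]
  · intro t _ ht
    simp [blockDiag, ht.symm]
  · simp

theorem blockDiag_transpose (P : Fin T → Matrix (Fin d) (Fin d) ℝ) :
    (blockDiag P).transpose = blockDiag fun t => (P t).transpose := by
  ext p q
  by_cases h : p.1 = q.1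
  · simp [blockDiag, h]
  · simp [blockDiag, h, Ne.symm h]

theorem blockDiag_one : blockDiag (fun _ : Fin T => (1 : Matrix (Fin d) (Fin d) ℝ)) = 1 := by
  ext p q
  by_cases h : p.1 = q.1 <;> simp [blockDiag, h, Matrix.one_apply, Prod.ext_iff]

theorem dotProduct_blockDiag_mulVec (P : Fin T → Matrix (Fin d) (Fin d) ℝ)
    (u v : Fin T × Fin d → ℝ) :
    u ⬝ᵥ (blockDiag P).mulVec v
      = ∑ t, (fun i => u (t, i)) ⬝ᵥ (P t).mulVec (fun i => v (t, i)) := by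
  rw [dotProduct, Fintype.sum_prod_type]
  refine Finset.sum_congr rfl fun t _ => ?_
  rw [dotProduct]
  refine Finset.sum_congr rfl fun i _ => ?_
  congr 1
  rw [Matrix.mulVec, Matrix.mulVec, dotProduct, dotProduct, Fintype.sum_prod_type,
    Finset.sum_eq_single t]
  · simp [blockDiag]
  · intro s _ hs
    simp [blockDiag, hs.symm]
  · simp

/-- A matrix is a contraction if and only if its bilinear form is dominated by half the sum of
the squared norms. -/
theorem isContraction_iff (D : Matrix (Fin d) (Fin d) ℝ) :
    IsContraction D ↔
      ∀ x y : Fin d → ℝ, 2 * (x ⬝ᵥ D.mulVec y) ≤ x ⬝ᵥ x + y ⬝ᵥ y := by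
  have hsq (x : Fin d → ℝ) : ‖WithLp.toLp 2 x‖ ^ 2 = x ⬝ᵥ x := by
    rw [EuclideanSpace.real_norm_sq_eq, dotProduct]
    exact Finset.sum_congr rfl fun i _ => by simp [sq]
  have hin (x y : Fin d → ℝ) : inner ℝ (WithLp.toLp 2 y) (WithLp.toLp 2 x) = x ⬝ᵥ y := by
    simp [PiLp.inner_apply, dotProduct]
  constructor
  · intro h x y
    have h1 : ‖Matrix.toEuclideanCLM (𝕜 := ℝ) D (WithLp.toLp 2 y)‖ ≤ ‖WithLp.toLp 2 y‖ :=
      (ContinuousLinearMap.le_of_opNorm_le _ h _).trans_eq (one_mul _)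
    have h2 := real_inner_le_norm (Matrix.toEuclideanCLM (𝕜 := ℝ) D (WithLp.toLp 2 y))
      (WithLp.toLp 2 x)
    rw [Matrix.toEuclideanCLM_toLp, hin] at h2
    rw [Matrix.toEuclideanCLM_toLp] at h1
    rw [← hsq, ← hsq]
    nlinarith [sq_nonneg (‖WithLp.toLp 2 x‖ - ‖WithLp.toLp 2 y‖), norm_nonneg (WithLp.toLp 2 x)]
  · intro h
    refine ContinuousLinearMap.opNorm_le_bound _ zero_le_one fun y => ?_
    rw [one_mul]
    obtain ⟨y, rfl⟩ : ∃ z, y = WithLp.toLp 2 z := ⟨y.ofLp, rfl⟩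
    rw [Matrix.toEuclideanCLM_toLp]
    have h1 := h (D.mulVec y) y
    rw [← sq_le_sq₀ (norm_nonneg _) (norm_nonneg _), hsq, hsq]
    linarith

/-- The covariance matrix of a pair of standard Gaussian vectors with cross covariance `Q`. -/
def pairCov (Q : BigMatrix T d) :
    Matrix ((Fin T × Fin d) ⊕ (Fin T × Fin d)) ((Fin T × Fin d) ⊕ (Fin T × Fin d)) ℝ :=
  Matrix.fromBlocks 1 Q Q.transpose 1

theorem posSemidef_pairCov {P : Fin T → Matrix (Fin d) (Fin d) ℝ}
    (hP : ∀ t, IsContraction (P t)) : (pairCov (blockDiag P)).PosSemidef := by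
  refine Matrix.PosSemidef.of_dotProduct_mulVec_nonneg ?_ fun z => ?_
  · rw [pairCov, Matrix.IsHermitian, Matrix.conjTranspose_eq_transpose_of_trivial,
      Matrix.fromBlocks_transpose]
    simp
  · obtain ⟨u, v, rfl⟩ : ∃ u v, z = Sum.elim u v := ⟨_, _, (Sum.elim_comp_inl_inr z).symm⟩
    have h1 : v ⬝ᵥ (blockDiag P).transpose.mulVec u = u ⬝ᵥ (blockDiag P).mulVec v := by
      rw [Matrix.mulVec_transpose, dotProduct_comm, Matrix.dotProduct_mulVec]
    have h2 (w : Fin T × Fin d → ℝ) :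
        w ⬝ᵥ w = ∑ t, (fun i => w (t, i)) ⬝ᵥ (fun i => w (t, i)) := by
      simp only [dotProduct, Fintype.sum_prod_type]
    have h3 : star (Sum.elim u v) ⬝ᵥ (pairCov (blockDiag P)).mulVec (Sum.elim u v)
        = u ⬝ᵥ u + v ⬝ᵥ v + 2 * (u ⬝ᵥ (blockDiag P).mulVec v) := by
      rw [pairCov, Matrix.fromBlocks_mulVec]
      simp only [star_trivial, Sum.elim_comp_inl, Sum.elim_comp_inr,
        Matrix.one_mulVec]
      rw [sumElim_dotProduct_sumElim, dotProduct_add, dotProduct_add, h1]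
      ring
    rw [h3, dotProduct_blockDiag_mulVec, h2 u, h2 v, Finset.mul_sum, ← Finset.sum_add_distrib,
      ← Finset.sum_add_distrib]
    refine Finset.sum_nonneg fun t _ => ?_
    have h4 := (isContraction_iff (P t)).1 (hP t) (-(fun i => u (t, i))) (fun i => v (t, i))
    simp only [neg_dotProduct, dotProduct_neg, neg_neg] at h4
    linarith

theorem isContraction_diagonal {c : Fin d → ℝ} (hc : ∀ i, |c i| ≤ 1) :
    IsContraction (Matrix.diagonal c) := by
  rw [isContraction_iff]
  intro x y
  simp only [dotProduct, Matrix.mulVec_diagonal, Finset.mul_sum, ← Finset.sum_add_distrib]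
  refine Finset.sum_le_sum fun i _ => ?_
  have h1 := abs_le.1 (hc i)
  nlinarith [sq_nonneg (x i - y i), sq_nonneg (x i + y i), mul_nonneg
    (sub_nonneg.2 h1.2) (sq_nonneg (x i + y i)), mul_nonneg (neg_le_iff_add_nonneg.1 h1.1)
      (sq_nonneg (x i - y i)), mul_nonneg (sub_nonneg.2 h1.2) (sq_nonneg (x i - y i)),
      mul_nonneg (neg_le_iff_add_nonneg.1 h1.1) (sq_nonneg (x i + y i))]

end LinearAlgebra

/-! ### Whitening and the split into past and future -/

section Whitening

variable {T d : ℕ}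

/-- The whitened coordinates `L⁻¹ (x - a)` of a path. -/
noncomputable def whiten (L : BigMatrix T d) (a x : Path T d) : Path T d :=
  Matrix.toEuclideanCLM (𝕜 := ℝ) L⁻¹ (x - a)

/-- The inverse `a + L u` of whitening. -/
noncomputable def colour (L : BigMatrix T d) (a u : Path T d) : Path T d :=
  a + Matrix.toEuclideanCLM (𝕜 := ℝ) L u

@[fun_prop]
theorem continuous_whiten (L : BigMatrix T d) (a : Path T d) : Continuous (whiten L a) := by
  unfold whiten; fun_prop

@[fun_prop]
theorem continuous_colour (L : BigMatrix T d) (a : Path T d) : Continuous (colour L a) := by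
  unfold colour; fun_prop

@[fun_prop]
theorem measurable_whiten (L : BigMatrix T d) (a : Path T d) : Measurable (whiten L a) :=
  (continuous_whiten L a).measurable

@[fun_prop]
theorem measurable_colour (L : BigMatrix T d) (a : Path T d) : Measurable (colour L a) :=
  (continuous_colour L a).measurable

theorem toEuclideanCLM_apply_apply (K : BigMatrix T d) (x : Path T d) (p : Fin T × Fin d) :
    Matrix.toEuclideanCLM (𝕜 := ℝ) K x p = ∑ q, K p q * x q := by
  rw [Matrix.ofLp_toEuclideanCLM]; rfl

theorem whiten_colour {L : BigMatrix T d} (hL : IsUnit L.det) (a u : Path T d) :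
    whiten L a (colour L a u) = u := by
  rw [whiten, colour, add_sub_cancel_left, ← mul_apply_eq_comp, ← map_mul,
    Matrix.nonsing_inv_mul _ hL, map_one, one_apply_eq_self]

theorem colour_whiten {L : BigMatrix T d} (hL : IsUnit L.det) (a x : Path T d) :
    colour L a (whiten L a x) = x := by
  rw [whiten, colour, ← mul_apply_eq_comp, ← map_mul,
    Matrix.mul_nonsing_inv _ hL, map_one, one_apply_eq_self, add_sub_cancel]

@[fun_prop]
theorem measurable_past (t : ℕ) : Measurable (past (T := T) (d := d) t) := by
  unfold past; fun_prop

@[fun_prop]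
theorem measurable_future (t : ℕ) : Measurable (future (T := T) (d := d) t) := by
  unfold future; fun_prop

/-- The path with prescribed past and future. -/
def glue (t : ℕ) (p : {s : Fin T // s.val < t} × Fin d → ℝ)
    (f : {s : Fin T // t ≤ s.val} × Fin d → ℝ) : Path T d :=
  WithLp.toLp 2 fun q =>
    if h : q.1.val < t then p (⟨q.1, h⟩, q.2) else f (⟨q.1, not_lt.1 h⟩, q.2)

@[fun_prop]
theorem measurable_glue (t : ℕ) :
    Measurable (fun z : ({s : Fin T // s.val < t} × Fin d → ℝ) ×
      ({s : Fin T // t ≤ s.val} × Fin d → ℝ) => glue t z.1 z.2) := by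
  unfold glue
  refine (WithLp.measurable_toLp 2 _).comp (measurable_pi_lambda _ fun q => ?_)
  by_cases h : q.1.val < t
  · simp only [h, dite_true]; fun_prop
  · simp only [h, dite_false]; fun_prop

theorem past_glue (t : ℕ) (p : {s : Fin T // s.val < t} × Fin d → ℝ)
    (f : {s : Fin T // t ≤ s.val} × Fin d → ℝ) : past t (glue t p f) = p := by
  ext q
  simp [past, glue, q.1.2]

theorem future_glue (t : ℕ) (p : {s : Fin T // s.val < t} × Fin d → ℝ)
    (f : {s : Fin T // t ≤ s.val} × Fin d → ℝ) : future t (glue t p f) = f := by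
  ext q
  simp [future, glue, q.1.2]

theorem glue_past_future (t : ℕ) (x : Path T d) : glue t (past t x) (future t x) = x := by
  ext q
  by_cases h : q.1.val < t <;> simp [past, future, glue]

theorem past_toEuclideanCLM {K : BigMatrix T d} (hK : TimeLower K) {t : ℕ} {x y : Path T d}
    (h : past t x = past t y) :
    past t (Matrix.toEuclideanCLM (𝕜 := ℝ) K x) = past t (Matrix.toEuclideanCLM (𝕜 := ℝ) K y) := by
  ext p
  simp only [past, toEuclideanCLM_apply_apply]
  refine Finset.sum_congr rfl fun q _ => ?_
  by_cases hq : q.1.val < t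
  · have := congrFun h (⟨q.1, hq⟩, q.2)
    simp only [past] at this
    rw [this]
  · rw [hK _ _ (show p.1.1 < q.1 from Fin.lt_def.2 (by have := p.1.2; omega)), zero_mul, zero_mul]

theorem past_colour {L : BigMatrix T d} (hL : TimeLower L) (a : Path T d) {t : ℕ} {x y : Path T d}
    (h : past t x = past t y) : past t (colour L a x) = past t (colour L a y) := by
  have := past_toEuclideanCLM hL h
  ext p
  have := congrFun this p
  simp only [past] at this
  simp [past, colour, this]

theorem past_whiten {L : BigMatrix T d} (hL : TimeLower L) (hdet : IsUnit L.det) (a : Path T d)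
    {t : ℕ} {x y : Path T d} (h : past t x = past t y) :
    past t (whiten L a x) = past t (whiten L a y) := by
  refine past_toEuclideanCLM (hL.inv hdet) ?_
  ext p
  have := congrFun h p
  simp only [past] at this
  simp [past, this]

end Whitening

/-! ### Conditional laws given by an independent innovation -/

section Innovation

open scoped ProbabilityTheory

variable {Ω α β γ δ : Type*} [MeasurableSpace Ω] [MeasurableSpace α] [MeasurableSpace β]
  [MeasurableSpace γ] [MeasurableSpace δ]

/-- The kernel sending `b` to the law of `e (b, n)`, where `n` has law `τ`. -/
noncomputable def innovationKernel (τ : Measure δ) [SFinite τ] (e : β × δ → γ) : Kernel β γ :=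
  (Kernel.id ×ₖ Kernel.const β τ).map e

theorem innovationKernel_apply (τ : Measure δ) [IsProbabilityMeasure τ] {e : β × δ → γ}
    (he : Measurable e) (b : β) :
    innovationKernel τ e b = τ.map fun n => e (b, n) := by
  rw [innovationKernel, Kernel.map_apply _ he, Kernel.prod_apply, Kernel.id_apply]
  rw [Kernel.const_apply, Measure.dirac_prod, Measure.map_map he (by fun_prop)]
  rfl

instance (τ : Measure δ) [IsFiniteMeasure τ] (e : β × δ → γ) :
    IsFiniteKernel (innovationKernel τ e) := by
  unfold innovationKernel; infer_instance

theorem compProd_innovationKernel (m : Measure α) [SFinite m] (τ : Measure δ)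
    [IsProbabilityMeasure τ] {e : β × δ → γ} (he : Measurable e) {g : α → β} (hg : Measurable g) :
    m ⊗ₘ (innovationKernel τ e).comap g hg
      = (m.prod τ).map fun z => (z.1, e (g z.1, z.2)) := by
  refine Measure.ext_of_lintegral _ fun f hf => ?_
  rw [Measure.lintegral_compProd hf, lintegral_map hf (by fun_prop), lintegral_prod _ (by fun_prop)]
  refine lintegral_congr fun x => ?_
  rw [Kernel.comap_apply, innovationKernel_apply τ he, lintegral_map (by fun_prop) (by fun_prop)]

/-- Let `F` be recovered from a variable `p = g H` and from an innovation `e' (p, F)` that is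
independent of `p`. Then the conditional law of `F` given the larger information `H` agrees with
the conditional law given `p` alone if and only if the innovation is independent of `H`. -/
theorem condDistrib_ae_eq_comap_iff_indepFun [StandardBorelSpace γ] [Nonempty γ]
    {π : Measure Ω} [IsProbabilityMeasure π] {H : Ω → α} {F : Ω → γ} (hH : Measurable H)
    (hF : Measurable F) {g : α → β} (hg : Measurable g) {e : β × δ → γ} (he : Measurable e)
    {e' : β × γ → δ} (he' : Measurable e') (hee' : ∀ b f, e (b, e' (b, f)) = f)
    (he'e : ∀ b n, e' (b, e (b, n)) = n) {K : Kernel β γ} [IsFiniteKernel K]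
    (hK : π.map (fun ω => (g (H ω), F ω)) = π.map (fun ω => g (H ω)) ⊗ₘ K)
    (hind : IndepFun (fun ω => g (H ω)) (fun ω => e' (g (H ω), F ω)) π) :
    (∀ᵐ h ∂π.map H, condDistrib F H π h = K (g h)) ↔
      IndepFun H (fun ω => e' (g (H ω), F ω)) π := by
  set ζ : Ω → δ := fun ω => e' (g (H ω), F ω) with hζ
  have hζm : Measurable ζ := by fun_prop
  have hp : Measurable fun ω => g (H ω) := hg.comp hH
  set τ := π.map ζ with hτ
  have : IsProbabilityMeasure τ := Measure.isProbabilityMeasure_map hζm.aemeasurable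
  have : IsProbabilityMeasure (π.map H) := Measure.isProbabilityMeasure_map hH.aemeasurable
  have : IsProbabilityMeasure (π.map fun ω => g (H ω)) :=
    Measure.isProbabilityMeasure_map hp.aemeasurable
  have hFe : ∀ ω, F ω = e (g (H ω), ζ ω) := fun ω => (hee' _ _).symm
  have hK' : π.map (fun ω => (g (H ω), F ω))
      = π.map (fun ω => g (H ω)) ⊗ₘ innovationKernel τ e := by
    have h1 := compProd_innovationKernel (π.map fun ω => g (H ω)) τ he measurable_id
    rw [Kernel.comap_id] at h1
    rw [h1, ← (indepFun_iff_map_prod_eq_prod_map_map hp.aemeasurable hζm.aemeasurable).1 hind,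
      Measure.map_map (by fun_prop) (by fun_prop)]
    congr 1
    funext ω
    simp [hFe ω]
  have hKK' : ∀ᵐ h ∂π.map H, K (g h) = innovationKernel τ e (g h) := by
    have h1 := condDistrib_ae_eq_of_measure_eq_compProd _ hF.aemeasurable hK
    have h2 := condDistrib_ae_eq_of_measure_eq_compProd _ hF.aemeasurable hK'
    have h3 := h1.symm.trans h2
    have h4 : π.map (fun ω => g (H ω)) = (π.map H).map g := (Measure.map_map hg hH).symm
    rw [h4] at h3
    exact ae_of_ae_map hg.aemeasurable h3
  have h5 : (∀ᵐ h ∂π.map H, condDistrib F H π h = K (g h)) ↔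
      condDistrib F H π =ᵐ[π.map H] (innovationKernel τ e).comap g hg := by
    constructor <;> intro h <;> filter_upwards [h, hKK'] with x hx hx'
    · rw [hx, hx', Kernel.comap_apply]
    · rw [hx, hx', Kernel.comap_apply]
  rw [h5, condDistrib_ae_eq_iff_measure_eq_compProd H hF.aemeasurable,
    compProd_innovationKernel _ _ he hg,
    indepFun_iff_map_prod_eq_prod_map_map hH.aemeasurable hζm.aemeasurable]
  have h6 : π.map (fun ω => (H ω, F ω))
      = (π.map fun ω => (H ω, ζ ω)).map fun z => (z.1, e (g z.1, z.2)) := by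
    rw [Measure.map_map (by fun_prop) (by fun_prop)]
    congr 1
    funext ω
    simp [hFe ω]
  rw [h6]
  refine ⟨fun h => ?_, fun h => by rw [h]⟩
  have h7 (m : Measure (α × δ)) : (m.map fun z => (z.1, e (g z.1, z.2))).map
      (fun z : α × γ => (z.1, e' (g z.1, z.2))) = m := by
    rw [Measure.map_map (by fun_prop) (by fun_prop)]
    convert! Measure.map_id
    funext z
    simp [he'e]
  rw [← h7 (π.map fun ω => (H ω, ζ ω)), h, h7]

end Innovation

/-! ### Gaussian vectors -/

section GaussianVectors

variable {Ω κ : Type*} [MeasurableSpace Ω] [Fintype κ]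

theorem hasGaussianLaw_sub_const {E : Type*} [NormedAddCommGroup E] [NormedSpace ℝ E]
    [MeasurableSpace E] [BorelSpace E] [SecondCountableTopology E] {P : Measure Ω} {X : Ω → E}
    (hX : HasGaussianLaw X P) (c : E) : HasGaussianLaw (fun ω => X ω - c) P where
  isGaussian_map := by
    have := hX.isGaussian_map
    have h : P.map (fun ω => X ω - c) = (P.map X).map (fun x => x - c) := by
      rw [AEMeasurable.map_map_of_aemeasurable (by fun_prop) hX.aemeasurable]
      rfl
    rw [h]
    infer_instance

theorem memLp_two_apply {P : Measure Ω} {X : Ω → EuclideanSpace ℝ κ}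
    (hX : HasGaussianLaw X P) (k : κ) : MemLp (fun ω => X ω k) 2 P :=
  (hX.map_fun (EuclideanSpace.proj (𝕜 := ℝ) k)).memLp_two

/-- A Gaussian vector is determined by the means and the covariances of its coordinates. -/
theorem map_eq_multivariateGaussian [DecidableEq κ] {P : Measure Ω} {X : Ω → EuclideanSpace ℝ κ}
    (hX : HasGaussianLaw X P) {c : EuclideanSpace ℝ κ} {S : Matrix κ κ ℝ} (hS : S.PosSemidef)
    (hmean : ∀ k, ∫ ω, X ω k ∂P = c k)
    (hcov : ∀ k l, cov[fun ω => X ω k, fun ω => X ω l; P] = S k l) :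
    P.map X = multivariateGaussian c S := by
  have := hX.isGaussian_map
  have := hX.isProbabilityMeasure
  apply IsGaussian.ext
  · rw [integral_id_multivariateGaussian', integral_map hX.aemeasurable (by fun_prop)]
    ext k
    have h := (EuclideanSpace.proj (𝕜 := ℝ) k).integral_comp_comm hX.integrable
    simp only [PiLp.proj_apply] at h
    simp only [id]
    rw [← h, hmean]
  · rw [← ContinuousLinearMap.toBilinForm_inj]
    refine LinearMap.BilinForm.ext_basis (EuclideanSpace.basisFun κ ℝ).toBasis fun i j => ?_
    rw [ContinuousLinearMap.toBilinForm_apply, ContinuousLinearMap.toBilinForm_apply,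
      covarianceBilin_apply_eq_cov, covariance_map (by fun_prop) (by fun_prop) hX.aemeasurable,
      covarianceBilin_multivariateGaussian hS]
    · have h (i : κ) : (fun u => inner ℝ ((EuclideanSpace.basisFun κ ℝ).toBasis i) u) ∘ X
          = fun ω => X ω i := by
        ext ω; simp [PiLp.inner_apply]
      rw [h, h, hcov]
      simp
    · exact IsGaussian.memLp_two_id

/-- The covariance matrix of a linear image. -/
theorem covariance_mulVec {P : Measure Ω} [IsFiniteMeasure P] {X : κ → Ω → ℝ}
    (hX : ∀ k, MemLp (X k) 2 P) {S : Matrix κ κ ℝ} (hS : ∀ k l, cov[X k, X l; P] = S k l)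
    {ι : Type*} (W : Matrix ι κ ℝ) (i j : ι) :
    cov[fun ω => ∑ k, W i k * X k ω, fun ω => ∑ l, W j l * X l ω; P]
      = (W * S * W.transpose) i j := by
  rw [covariance_fun_sum_fun_sum (fun k => (hX k).const_mul _) (fun k => (hX k).const_mul _),
    Matrix.mul_assoc, Matrix.mul_apply]
  refine Finset.sum_congr rfl fun k _ => ?_
  rw [Matrix.mul_apply, Finset.mul_sum]
  refine Finset.sum_congr rfl fun l _ => ?_
  rw [covariance_const_mul_left, covariance_const_mul_right, hS, Matrix.transpose_apply]
  ring

theorem integral_apply_multivariateGaussian [DecidableEq κ] (c : EuclideanSpace ℝ κ)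
    (S : Matrix κ κ ℝ) (k : κ) : ∫ x, x k ∂(multivariateGaussian c S) = c k := by
  have h := (EuclideanSpace.proj (𝕜 := ℝ) k).integral_comp_comm
    (IsGaussian.integrable_id (μ := multivariateGaussian c S))
  simp only [PiLp.proj_apply, id] at h
  rw [h, integral_id_multivariateGaussian]

theorem map_affine_multivariateGaussian [DecidableEq κ] (c : EuclideanSpace ℝ κ)
    {S : Matrix κ κ ℝ} (hS : S.PosSemidef) (K : Matrix κ κ ℝ) :
    (multivariateGaussian 0 S).map (fun x => c + Matrix.toEuclideanCLM (𝕜 := ℝ) K x)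
      = multivariateGaussian c (K * S * K.transpose) := by
  have h0 : HasGaussianLaw (fun x : EuclideanSpace ℝ κ => x) (multivariateGaussian 0 S) :=
    IsGaussian.hasGaussianLaw_id
  have h1 : HasGaussianLaw (fun x => c + Matrix.toEuclideanCLM (𝕜 := ℝ) K x)
      (multivariateGaussian 0 S) := by
    have := hasGaussianLaw_sub_const (h0.map_fun (Matrix.toEuclideanCLM (𝕜 := ℝ) K)) (-c)
    simpa [add_comm] using this
  have hK (x : EuclideanSpace ℝ κ) (k : κ) :
      Matrix.toEuclideanCLM (𝕜 := ℝ) K x k = ∑ l, K k l * x l := by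
    rw [Matrix.ofLp_toEuclideanCLM]; rfl
  have h2 (k : κ) : MemLp (fun x : EuclideanSpace ℝ κ => x k) 2 (multivariateGaussian 0 S) :=
    memLp_two_apply h0 k
  have h3 (k : κ) : Integrable (fun x => ∑ l, K k l * x l) (multivariateGaussian 0 S) :=
    integrable_finsetSum _ fun l _ => ((h2 l).integrable one_le_two).const_mul _
  refine map_eq_multivariateGaussian h1 ?_ (fun k => ?_) fun k l => ?_
  · simpa [Matrix.conjTranspose_eq_transpose_of_trivial] using hS.mul_mul_conjTranspose_same K
  · simp only [PiLp.add_apply, hK]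
    rw [integral_add (integrable_const _) (h3 k), integral_finsetSum]
    · simp [integral_const_mul, integral_apply_multivariateGaussian]
    · exact fun l _ => ((h2 l).integrable one_le_two).const_mul _
  · simp only [PiLp.add_apply, hK]
    rw [covariance_const_add_left (h3 k), covariance_const_add_right (h3 l)]
    exact covariance_mulVec h2 (covariance_eval_multivariateGaussian hS) K k l

/-- Uncorrelated groups of coordinates of a Gaussian vector are independent. -/
theorem indepFun_of_covariance_apply {P : Measure Ω} {X : Ω → EuclideanSpace ℝ κ}
    (hX : HasGaussianLaw X P) {ι ι' : Type*} [Finite ι] [Finite ι'] (f : ι → κ) (g : ι' → κ)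
    (h : ∀ i j, cov[fun ω => X ω (f i), fun ω => X ω (g j); P] = 0) :
    IndepFun (fun ω i => X ω (f i)) (fun ω j => X ω (g j)) P := by
  have := Fintype.ofFinite ι
  have := Fintype.ofFinite ι'
  refine HasGaussianLaw.indepFun_of_covariance_eval (X := fun i ω => X ω (f i))
    (Y := fun j ω => X ω (g j)) ?_ h
  exact hX.map_fun (ContinuousLinearMap.prod
    (ContinuousLinearMap.pi fun i => EuclideanSpace.proj (𝕜 := ℝ) (f i))
    (ContinuousLinearMap.pi fun j => EuclideanSpace.proj (𝕜 := ℝ) (g j)))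

end GaussianVectors

/-! ### Whitened Gaussian laws -/

section WhitenedLaws

variable {T d : ℕ}

/-- The whitened coordinates of a pair of paths, as one vector. -/
noncomputable def whitenPair (L M : BigMatrix T d) (a b : Path T d) (z : Path T d × Path T d) :
    EuclideanSpace ℝ ((Fin T × Fin d) ⊕ (Fin T × Fin d)) :=
  WithLp.toLp 2 (Sum.elim (whiten L a z.1) (whiten M b z.2))

/-- The inverse of `whitenPair`. -/
noncomputable def colourPair (L M : BigMatrix T d) (a b : Path T d)
    (w : EuclideanSpace ℝ ((Fin T × Fin d) ⊕ (Fin T × Fin d))) : Path T d × Path T d :=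
  (colour L a (splitPair w).1, colour M b (splitPair w).2)

variable (L M : BigMatrix T d) (a b : Path T d)

@[simp]
theorem whitenPair_inl (z : Path T d × Path T d) (p : Fin T × Fin d) :
    whitenPair L M a b z (Sum.inl p) = whiten L a z.1 p := rfl

@[simp]
theorem whitenPair_inr (z : Path T d × Path T d) (p : Fin T × Fin d) :
    whitenPair L M a b z (Sum.inr p) = whiten M b z.2 p := rfl

@[fun_prop]
theorem measurable_whitenPair : Measurable (whitenPair L M a b) := by
  unfold whitenPair
  refine (WithLp.measurable_toLp 2 _).comp (measurable_pi_lambda _ fun k => ?_)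
  cases k <;> simp only [Sum.elim_inl, Sum.elim_inr] <;> fun_prop

@[fun_prop]
theorem measurable_colourPair : Measurable (colourPair L M a b) := by
  have := measurable_splitPair (T := T) (d := d)
  unfold colourPair
  fun_prop

variable {L M}

theorem colourPair_whitenPair (hL : IsUnit L.det) (hM : IsUnit M.det)
    (z : Path T d × Path T d) : colourPair L M a b (whitenPair L M a b z) = z := by
  have h : splitPair (whitenPair L M a b z) = (whiten L a z.1, whiten M b z.2) := rfl
  rw [colourPair, h, colour_whiten hL, colour_whiten hM]

theorem whitenPair_colourPair (hL : IsUnit L.det) (hM : IsUnit M.det)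
    (w : EuclideanSpace ℝ ((Fin T × Fin d) ⊕ (Fin T × Fin d))) :
    whitenPair L M a b (colourPair L M a b w) = w := by
  rw [whitenPair, colourPair, whiten_colour hL, whiten_colour hM]
  ext k
  cases k <;> rfl

theorem map_colourPair_map_whitenPair (hL : IsUnit L.det) (hM : IsUnit M.det)
    (ρ : Measure (Path T d × Path T d)) :
    (ρ.map (whitenPair L M a b)).map (colourPair L M a b) = ρ := by
  rw [Measure.map_map (by fun_prop) (by fun_prop)]
  convert! Measure.map_id
  funext z
  exact colourPair_whitenPair a b hL hM z

variable (L M)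

theorem hasGaussianLaw_whitenPair (ρ : Measure (Path T d × Path T d)) [IsGaussian ρ] :
    HasGaussianLaw (whitenPair L M a b) ρ := by
  let J : (Path T d × Path T d) →L[ℝ] EuclideanSpace ℝ ((Fin T × Fin d) ⊕ (Fin T × Fin d)) :=
    LinearMap.toContinuousLinearMap
      { toFun := fun z => WithLp.toLp 2 (Sum.elim (Matrix.toEuclideanCLM (𝕜 := ℝ) L⁻¹ z.1)
          (Matrix.toEuclideanCLM (𝕜 := ℝ) M⁻¹ z.2))
        map_add' := fun z w => by ext k; cases k <;> simp
        map_smul' := fun c z => by ext k; cases k <;> simp }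
  have h0 : HasGaussianLaw (fun z : Path T d × Path T d => z) ρ := IsGaussian.hasGaussianLaw_id
  exact (hasGaussianLaw_sub_const h0 (a, b)).map_fun J

variable {L M}

theorem gaussian_eq_map_colour :
    (gaussian a (L * L.transpose) : Measure (Path T d))
      = (multivariateGaussian 0 1).map (colour L a) := by
  have := map_affine_multivariateGaussian a (Matrix.PosSemidef.one (n := Fin T × Fin d)
    (R := ℝ)) L
  rw [mul_one] at this
  exact this.symm

theorem map_whiten_gaussian (hL : IsUnit L.det) :
    (gaussian a (L * L.transpose) : Measure (Path T d)).map (whiten L a)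
      = multivariateGaussian 0 1 := by
  rw [gaussian_eq_map_colour, Measure.map_map (by fun_prop) (by fun_prop)]
  convert! Measure.map_id
  funext u
  exact whiten_colour hL a u

/-- For contractions the matrix in the definition of `gaussianCoupling` is a covariance matrix,
and whitening turns the coupling into a pair of standard Gaussian vectors with cross covariance
`diag(P_1, …, P_T)`. -/
theorem gaussianCoupling_eq_map_colourPair {P : Fin T → Matrix (Fin d) (Fin d) ℝ}
    (hP : ∀ t, IsContraction (P t)) :
    (gaussianCoupling a b L M P : Measure (Path T d × Path T d))
      = (multivariateGaussian 0 (pairCov (blockDiag P))).map (colourPair L M a b) := by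
  have h1 : Matrix.fromBlocks (L * L.transpose) (L * blockDiag P * M.transpose)
      (M * (blockDiag P).transpose * L.transpose) (M * M.transpose)
      = Matrix.fromBlocks L 0 0 M * pairCov (blockDiag P)
        * (Matrix.fromBlocks L 0 0 M).transpose := by
    rw [pairCov, Matrix.fromBlocks_transpose, Matrix.fromBlocks_multiply,
      Matrix.fromBlocks_multiply]
    simp
  have h2 : (gaussianCoupling a b L M P : Measure (Path T d × Path T d))
      = (multivariateGaussian (WithLp.toLp 2 (Sum.elim (fun p => a p) (fun p => b p)))
      (Matrix.fromBlocks (L * L.transpose) (L * blockDiag P * M.transpose)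
        (M * (blockDiag P).transpose * L.transpose) (M * M.transpose))).map splitPair := rfl
  rw [h2, h1, ← map_affine_multivariateGaussian _ (posSemidef_pairCov hP),
    Measure.map_map measurable_splitPair (by fun_prop)]
  congr 1
  funext w
  have hw : (Matrix.fromBlocks L 0 0 M).mulVec w
      = Sum.elim (L.mulVec (w.ofLp ∘ Sum.inl)) (M.mulVec (w.ofLp ∘ Sum.inr)) := by
    obtain ⟨u, v, h⟩ : ∃ u v, w.ofLp = Sum.elim u v := ⟨_, _, (Sum.elim_comp_inl_inr _).symm⟩
    rw [h, Matrix.fromBlocks_mulVec]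
    simp
  refine Prod.ext ?_ ?_ <;> ext p <;>
    simp [splitPair, colourPair, colour, Matrix.ofLp_toEuclideanCLM, hw] <;> rfl

theorem map_whitenPair_gaussianCoupling (hL : IsUnit L.det) (hM : IsUnit M.det)
    {P : Fin T → Matrix (Fin d) (Fin d) ℝ} (hP : ∀ t, IsContraction (P t)) :
    (gaussianCoupling a b L M P : Measure (Path T d × Path T d)).map (whitenPair L M a b)
      = multivariateGaussian 0 (pairCov (blockDiag P)) := by
  rw [gaussianCoupling_eq_map_colourPair a b hP, Measure.map_map (by fun_prop) (by fun_prop)]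
  convert! Measure.map_id
  funext w
  exact whitenPair_colourPair a b hL hM w

end WhitenedLaws

section Moments

variable {Ω κ : Type*} [MeasurableSpace Ω] [Fintype κ] [DecidableEq κ] {P : Measure Ω}
  {X : Ω → EuclideanSpace ℝ κ} {c : EuclideanSpace ℝ κ} {S : Matrix κ κ ℝ}

theorem hasGaussianLaw_of_map_eq (h : P.map X = multivariateGaussian c S) :
    HasGaussianLaw X P := ⟨by rw [h]; infer_instance⟩

theorem integral_apply_of_map_eq (h : P.map X = multivariateGaussian c S) (k : κ) :
    ∫ ω, X ω k ∂P = c k := by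
  rw [← integral_apply_multivariateGaussian c S k, ← h,
    integral_map (hasGaussianLaw_of_map_eq h).aemeasurable (by fun_prop)]

theorem covariance_apply_of_map_eq (h : P.map X = multivariateGaussian c S) (hS : S.PosSemidef)
    (k l : κ) : cov[fun ω => X ω k, fun ω => X ω l; P] = S k l := by
  rw [← covariance_eval_multivariateGaussian (μ := c) hS k l, ← h,
    covariance_map_fun (by fun_prop) (by fun_prop) (hasGaussianLaw_of_map_eq h).aemeasurable]

end Moments

/-! ### Bi-causality in terms of whitened coordinates -/

section Causality

variable {T d : ℕ} {L M : BigMatrix T d}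

theorem past_eq_of_past_whiten (hL : TimeLower L) (hdet : IsUnit L.det) (a : Path T d) (t : ℕ)
    (x : Path T d) : past t x = past t (colour L a (glue t (past t (whiten L a x)) 0)) := by
  conv_lhs => rw [← colour_whiten hdet a x]
  exact past_colour hL a (past_glue _ _ _).symm

/-- A process with Gaussian law is causal with respect to the information `H` at time `t` if and
only if its whitened future is independent of `H`. -/
theorem condDistrib_future_iff_indepFun {Ω α : Type*} [MeasurableSpace Ω] [MeasurableSpace α]
    (hL : TimeLower L) (hdet : IsUnit L.det) (a : Path T d) (t : ℕ) {π : Measure Ω}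
    [IsProbabilityMeasure π] {H : Ω → α} (hH : Measurable H) {X : Ω → Path T d}
    (hX : Measurable X) {g : α → {s : Fin T // s.val < t} × Fin d → ℝ} (hg : Measurable g)
    (hgX : ∀ ω, g (H ω) = past t (X ω))
    (hlaw : π.map X = gaussian a (L * L.transpose)) :
    (∀ᵐ h ∂π.map H, condDistrib (fun ω => future t (X ω)) H π h
        = condDistrib (future t) (past t)
            (gaussian a (L * L.transpose) : Measure (Path T d)) (g h)) ↔
      IndepFun H (fun ω => future t (whiten L a (X ω))) π := by
  have hwhite : π.map (fun ω => whiten L a (X ω)) = multivariateGaussian 0 1 := by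
    rw [← map_whiten_gaussian a hdet, ← hlaw, Measure.map_map (by fun_prop) hX]
    rfl
  have hind : IndepFun (fun ω => past t (X ω)) (fun ω => future t (whiten L a (X ω))) π := by
    have h1 := indepFun_of_covariance_apply (hasGaussianLaw_of_map_eq hwhite)
      (fun p : {s : Fin T // s.val < t} × Fin d => (p.1.1, p.2))
      (fun p : {s : Fin T // t ≤ s.val} × Fin d => (p.1.1, p.2)) fun p q => by
        rw [covariance_apply_of_map_eq hwhite Matrix.PosSemidef.one, Matrix.one_apply_ne]
        intro h
        have h2 := congrArg Prod.fst h
        have h3 := p.1.2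
        have h4 := q.1.2
        simp only at h2
        rw [h2] at h3
        omega
    have h2 := h1.comp (φ := fun p => past t (colour L a (glue t p 0))) (ψ := id)
      (by fun_prop) measurable_id
    convert! h2 using 1
    funext ω
    exact past_eq_of_past_whiten hL hdet a t (X ω)
  -- Given the past, `e` maps the innovations to the future, and `e'` inverts it; the zero future
  let e : ({s : Fin T // s.val < t} × Fin d → ℝ) × ({s : Fin T // t ≤ s.val} × Fin d → ℝ) →
      ({s : Fin T // t ≤ s.val} × Fin d → ℝ) := fun z =>
    future t (colour L a (glue t (past t (whiten L a (glue t z.1 0))) z.2))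
  let e' : ({s : Fin T // s.val < t} × Fin d → ℝ) × ({s : Fin T // t ≤ s.val} × Fin d → ℝ) →
      ({s : Fin T // t ≤ s.val} × Fin d → ℝ) := fun z => future t (whiten L a (glue t z.1 z.2))
  have he : Measurable e := by fun_prop
  have he' : Measurable e' := by fun_prop
  have hee' (p : {s : Fin T // s.val < t} × Fin d → ℝ)
      (f : {s : Fin T // t ≤ s.val} × Fin d → ℝ) : e (p, e' (p, f)) = f := by
    have h1 : past t (whiten L a (glue t p 0)) = past t (whiten L a (glue t p f)) :=
      past_whiten hL hdet a (by rw [past_glue, past_glue])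
    simp only [e, e']
    rw [h1, glue_past_future, colour_whiten hdet, future_glue]
  have he'e (p : {s : Fin T // s.val < t} × Fin d → ℝ)
      (n : {s : Fin T // t ≤ s.val} × Fin d → ℝ) : e' (p, e (p, n)) = n := by
    simp only [e, e']
    set u := glue t (past t (whiten L a (glue t p 0))) n with hu
    have h1 : past t (colour L a u) = p := by
      rw [past_colour hL a (y := whiten L a (glue t p 0)) (by rw [hu, past_glue]),
        colour_whiten hdet, past_glue]
    have h2 : glue t p (future t (colour L a u)) = colour L a u := by
      conv_rhs => rw [← glue_past_future t (colour L a u), h1]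
    rw [h2, whiten_colour hdet, hu, future_glue]
  have he'X : (fun ω => e' (g (H ω), future t (X ω)))
      = fun ω => future t (whiten L a (X ω)) := by
    funext ω
    simp only [e', hgX, glue_past_future]
  have hK : π.map (fun ω => (g (H ω), future t (X ω)))
      = π.map (fun ω => g (H ω)) ⊗ₘ condDistrib (future t) (past t)
          (gaussian a (L * L.transpose) : Measure (Path T d)) := by
    simp only [hgX]
    have h1 := compProd_map_condDistrib (mβ := inferInstance) (X := past t)
      (μ := (gaussian a (L * L.transpose) : Measure (Path T d)))
      (measurable_future (T := T) (d := d) t).aemeasurable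
    have h2 : π.map (fun ω => past t (X ω))
        = (gaussian a (L * L.transpose) : Measure (Path T d)).map (past t) := by
      rw [← hlaw, Measure.map_map (by fun_prop) hX]
      rfl
    rw [h2, h1, ← hlaw, Measure.map_map (by fun_prop) hX]
    rfl
  have key := condDistrib_ae_eq_comap_iff_indepFun (π := π) hH (F := fun ω => future t (X ω))
    (by fun_prop) hg he he' hee' he'e hK (by rw [he'X]; simpa only [hgX] using hind)
  rwa [he'X] at key

/-- A coupling of two Gaussian laws is bi-causal if and only if at each time the whitened future
of either process is independent of the joint past. -/
theorem mem_bicausalCouplings_iff (hL : TimeLower L) (hLdet : IsUnit L.det) (hM : TimeLower M)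
    (hMdet : IsUnit M.det) (a b : Path T d)
    (π : ProbabilityMeasure (Path T d × Path T d)) :
    π ∈ bicausalCouplings (gaussian a (L * L.transpose)) (gaussian b (M * M.transpose)) ↔
      (π : Measure (Path T d × Path T d)).fst = gaussian a (L * L.transpose) ∧
      (π : Measure (Path T d × Path T d)).snd = gaussian b (M * M.transpose) ∧
      ∀ t : ℕ, 1 ≤ t → t < T →
        IndepFun (fun z : Path T d × Path T d => (past t z.1, past t z.2))
          (fun z => future t (whiten L a z.1)) (π : Measure (Path T d × Path T d)) ∧
        IndepFun (fun z : Path T d × Path T d => (past t z.1, past t z.2))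
          (fun z => future t (whiten M b z.2)) (π : Measure (Path T d × Path T d)) := by
  refine and_congr_right fun h1 => and_congr_right fun h2 => forall_congr' fun t =>
    forall_congr' fun _ => forall_congr' fun _ => ?_
  have hH : Measurable fun z : Path T d × Path T d => (past t z.1, past t z.2) := by fun_prop
  rw [Filter.eventually_and,
    ← condDistrib_future_iff_indepFun hL hLdet a t hH measurable_fst measurable_fst
      (fun _ => rfl) h1,
    ← condDistrib_future_iff_indepFun hM hMdet b t hH measurable_snd measurable_snd
      (fun _ => rfl) h2]
  have hF : Measurable fun z : Path T d × Path T d => (future t z.1, future t z.2) := by fun_prop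
  have h3 := condDistrib_comp (mβ := inferInstance) (μ := (π : Measure (Path T d × Path T d)))
    (fun z : Path T d × Path T d => (past t z.1, past t z.2)) hF.aemeasurable measurable_fst
  have h4 := condDistrib_comp (mβ := inferInstance) (μ := (π : Measure (Path T d × Path T d)))
    (fun z : Path T d × Path T d => (past t z.1, past t z.2)) hF.aemeasurable measurable_snd
  refine and_congr ⟨fun h => ?_, fun h => ?_⟩ ⟨fun h => ?_, fun h => ?_⟩
  · filter_upwards [h, h3] with x hx hx'
    rw [← hx, Measure.fst, ← Kernel.map_apply _ measurable_fst]
    exact hx'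
  · filter_upwards [h, h3] with x hx hx'
    rw [← hx, Measure.fst, ← Kernel.map_apply _ measurable_fst]
    exact hx'.symm
  · filter_upwards [h, h4] with x hx hx'
    rw [← hx, Measure.snd, ← Kernel.map_apply _ measurable_snd]
    exact hx'
  · filter_upwards [h, h4] with x hx hx'
    rw [← hx, Measure.snd, ← Kernel.map_apply _ measurable_snd]
    exact hx'.symm

end Causality

/-! ### The Gaussian couplings are bi-causal -/

section GaussianCouplings

variable {T d : ℕ} {L M : BigMatrix T d} (a b : Path T d)

theorem fst_gaussianCoupling (hL : IsUnit L.det) (hM : IsUnit M.det)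
    {P : Fin T → Matrix (Fin d) (Fin d) ℝ} (hP : ∀ t, IsContraction (P t)) :
    (gaussianCoupling a b L M P : Measure (Path T d × Path T d)).fst
      = gaussian a (L * L.transpose) := by
  have hW := map_whitenPair_gaussianCoupling a b hL hM hP
  have h1 : (gaussianCoupling a b L M P : Measure (Path T d × Path T d)).map
      (fun z => whiten L a z.1) = multivariateGaussian 0 1 := by
    refine map_eq_multivariateGaussian ?_ Matrix.PosSemidef.one (fun k => ?_) fun k l => ?_
    · exact (hasGaussianLaw_of_map_eq hW).map_fun (LinearMap.toContinuousLinearMap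
        { toFun := fun w : EuclideanSpace ℝ ((Fin T × Fin d) ⊕ (Fin T × Fin d)) =>
            (WithLp.toLp 2 fun p => w (Sum.inl p) : Path T d)
          map_add' := fun _ _ => rfl
          map_smul' := fun _ _ => rfl })
    · exact integral_apply_of_map_eq hW (Sum.inl k)
    · exact covariance_apply_of_map_eq hW (posSemidef_pairCov hP) (Sum.inl k) (Sum.inl l)
  rw [gaussian_eq_map_colour, ← h1, Measure.map_map (by fun_prop) (by fun_prop), Measure.fst]
  congr 1
  funext z
  exact (colour_whiten hL a z.1).symm

theorem snd_gaussianCoupling (hL : IsUnit L.det) (hM : IsUnit M.det)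
    {P : Fin T → Matrix (Fin d) (Fin d) ℝ} (hP : ∀ t, IsContraction (P t)) :
    (gaussianCoupling a b L M P : Measure (Path T d × Path T d)).snd
      = gaussian b (M * M.transpose) := by
  have hW := map_whitenPair_gaussianCoupling a b hL hM hP
  have h1 : (gaussianCoupling a b L M P : Measure (Path T d × Path T d)).map
      (fun z => whiten M b z.2) = multivariateGaussian 0 1 := by
    refine map_eq_multivariateGaussian ?_ Matrix.PosSemidef.one (fun k => ?_) fun k l => ?_
    · exact (hasGaussianLaw_of_map_eq hW).map_fun (LinearMap.toContinuousLinearMap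
        { toFun := fun w : EuclideanSpace ℝ ((Fin T × Fin d) ⊕ (Fin T × Fin d)) =>
            (WithLp.toLp 2 fun p => w (Sum.inr p) : Path T d)
          map_add' := fun _ _ => rfl
          map_smul' := fun _ _ => rfl })
    · exact integral_apply_of_map_eq hW (Sum.inr k)
    · exact covariance_apply_of_map_eq hW (posSemidef_pairCov hP) (Sum.inr k) (Sum.inr l)
  rw [gaussian_eq_map_colour, ← h1, Measure.map_map (by fun_prop) (by fun_prop), Measure.snd]
  congr 1
  funext z
  exact (colour_whiten hM b z.2).symm

theorem gaussianCoupling_mem_bicausalCouplings (hL : TimeLower L) (hLdet : IsUnit L.det)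
    (hM : TimeLower M) (hMdet : IsUnit M.det) {P : Fin T → Matrix (Fin d) (Fin d) ℝ}
    (hP : ∀ t, IsContraction (P t)) :
    gaussianCoupling a b L M P
      ∈ bicausalCouplings (gaussian a (L * L.transpose)) (gaussian b (M * M.transpose)) := by
  refine (mem_bicausalCouplings_iff hL hLdet hM hMdet a b _).2
    ⟨fst_gaussianCoupling a b hLdet hMdet hP, snd_gaussianCoupling a b hLdet hMdet hP,
      fun t _ _ => ?_⟩
  have hW := map_whitenPair_gaussianCoupling a b hLdet hMdet hP
  let pastIdx : ({s : Fin T // s.val < t} × Fin d) ⊕ ({s : Fin T // s.val < t} × Fin d) →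
      (Fin T × Fin d) ⊕ (Fin T × Fin d) := Sum.map (fun p => (p.1.1, p.2)) fun p => (p.1.1, p.2)
  have hne (p : {s : Fin T // s.val < t} × Fin d) (q : {s : Fin T // t ≤ s.val} × Fin d) :
      p.1.1 ≠ q.1.1 := by
    intro h
    have h1 := p.1.2
    rw [h] at h1
    exact absurd q.1.2 (not_le.2 h1)
  -- all coordinates of the joint past are uncorrelated with all coordinates of the futures
  have hcov (i) (q : {s : Fin T // t ≤ s.val} × Fin d) :
      pairCov (blockDiag P) (pastIdx i) (Sum.inl (q.1.1, q.2)) = 0 ∧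
        pairCov (blockDiag P) (pastIdx i) (Sum.inr (q.1.1, q.2)) = 0 := by
    rcases i with p | p <;>
      simp [pastIdx, pairCov, blockDiag, hne p q, (hne p q).symm]
  have hpast : (fun z : Path T d × Path T d => (past t z.1, past t z.2))
      = (fun w => (past t (colour L a (glue t (fun p => w (Sum.inl p)) 0)),
          past t (colour M b (glue t (fun p => w (Sum.inr p)) 0)))) ∘
        fun z i => whitenPair L M a b z (pastIdx i) := by
    funext z
    exact Prod.ext (past_eq_of_past_whiten hL hLdet a t z.1)
      (past_eq_of_past_whiten hM hMdet b t z.2)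
  have hmeas : Measurable fun w : ({s : Fin T // s.val < t} × Fin d) ⊕
      ({s : Fin T // s.val < t} × Fin d) → ℝ =>
      (past t (colour L a (glue t (fun p => w (Sum.inl p)) 0)),
          past t (colour M b (glue t (fun p => w (Sum.inr p)) 0))) := by
    fun_prop
  constructor
  · have h1 := indepFun_of_covariance_apply (hasGaussianLaw_of_map_eq hW) pastIdx
      (fun q : {s : Fin T // t ≤ s.val} × Fin d => Sum.inl (q.1.1, q.2)) fun i q => by
        rw [covariance_apply_of_map_eq hW (posSemidef_pairCov hP), (hcov i q).1]
    rw [hpast]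
    exact h1.comp hmeas measurable_id
  · have h1 := indepFun_of_covariance_apply (hasGaussianLaw_of_map_eq hW) pastIdx
      (fun q : {s : Fin T // t ≤ s.val} × Fin d => Sum.inr (q.1.1, q.2)) fun i q => by
        rw [covariance_apply_of_map_eq hW (posSemidef_pairCov hP), (hcov i q).2]
    rw [hpast]
    exact h1.comp hmeas measurable_id

end GaussianCouplings

/-! ### Densities -/

section Densities

theorem withDensity_map {α β : Type*} [MeasurableSpace α] [MeasurableSpace β] (m : Measure α)
    {f : α → β} (hf : Measurable f) {g : β → ℝ≥0∞} (hg : Measurable g) :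
    (m.map f).withDensity g = (m.withDensity fun x => g (f x)).map f := by
  refine Measure.ext_of_lintegral _ fun h hh => ?_
  rw [lintegral_withDensity_eq_lintegral_mul _ hg hh, lintegral_map (hg.mul hh) hf,
    lintegral_map hh hf]
  exact (lintegral_withDensity_eq_lintegral_mul m (hg.comp hf) (hh.comp hf)).symm

/-- A finite product of measures with densities has the product density. -/
theorem pi_withDensity {ι : Type*} [Fintype ι] {E : ι → Type*} [∀ i, MeasurableSpace (E i)]
    (m : ∀ i, Measure (E i)) [∀ i, IsProbabilityMeasure (m i)] {h : ∀ i, E i → ℝ≥0∞}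
    (hh : ∀ i, Measurable (h i)) [∀ i, SigmaFinite ((m i).withDensity (h i))] :
    Measure.pi (fun i => (m i).withDensity (h i))
      = (Measure.pi m).withDensity fun x => ∏ i, h i (x i) := by
  refine Measure.pi_eq fun s hs => ?_
  rw [withDensity_apply _ (MeasurableSet.univ_pi hs), ← lintegral_indicator
    (MeasurableSet.univ_pi hs)]
  have h1 : (Set.univ.pi s).indicator (fun x : ∀ i, E i => ∏ i, h i (x i))
      = fun x => ∏ i, (s i).indicator (h i) (x i) := by
    funext x
    by_cases hx : x ∈ Set.univ.pi s
    · rw [Set.indicator_of_mem hx]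
      exact Finset.prod_congr rfl fun i _ => (Set.indicator_of_mem (hx i trivial) _).symm
    · rw [Set.indicator_of_notMem hx]
      simp only [Set.mem_pi, Set.mem_univ, true_imp_iff, not_forall] at hx
      obtain ⟨i, hi⟩ := hx
      exact (Finset.prod_eq_zero (Finset.mem_univ i) (Set.indicator_of_notMem hi _)).symm
  have h2 : ∀ i, Measurable ((s i).indicator (h i)) := fun i => (hh i).indicator (hs i)
  rw [h1, lintegral_prod_eq_prod_lintegral_of_indepFun Finset.univ
    (fun i (x : ∀ i, E i) => (s i).indicator (h i) (x i))
    (iIndepFun_pi fun i => (h2 i).aemeasurable) fun i => (h2 i).comp (measurable_pi_apply i)]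
  refine Finset.prod_congr rfl fun i _ => ?_
  rw [withDensity_apply _ (hs i), ← lintegral_indicator (hs i)]
  exact (measurePreserving_eval m i).lintegral_comp (h2 i)

/-- A probability measure whose density is proportional to `exp q` is the exponential tilting
by `q`. -/
theorem withDensity_eq_tilted {α : Type*} [MeasurableSpace α] {m ρ : Measure α}
    [IsProbabilityMeasure ρ] {C : ℝ} (hC : 0 < C) {q : α → ℝ} (hq : Measurable q)
    (h : ρ = m.withDensity fun x => ENNReal.ofReal (C * Real.exp (q x))) :
    Integrable (fun x => Real.exp (q x)) m ∧ ρ = m.tilted q := by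
  have h1 : ∫⁻ x, ENNReal.ofReal (C * Real.exp (q x)) ∂m = 1 := by
    rw [← setLIntegral_univ, ← withDensity_apply _ MeasurableSet.univ, ← h, measure_univ]
  have h2 : Integrable (fun x => C * Real.exp (q x)) m := by
    refine ⟨by fun_prop, ?_⟩
    rw [hasFiniteIntegral_iff_ofReal (ae_of_all _ fun x => by positivity), h1]
    exact ENNReal.one_lt_top
  have h3 : Integrable (fun x => Real.exp (q x)) m := by
    have := h2.const_mul C⁻¹
    simpa [← mul_assoc, inv_mul_cancel₀ hC.ne'] using this
  have h4 : C * ∫ x, Real.exp (q x) ∂m = 1 := by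
    rw [← integral_const_mul, ← ENNReal.ofReal_eq_one,
      ofReal_integral_eq_lintegral_ofReal h2 (ae_of_all _ fun x => by positivity), h1]
  refine ⟨h3, ?_⟩
  rw [h, Measure.tilted]
  congr 1
  funext x
  rw [eq_div_of_mul_eq (right_ne_zero_of_mul (h4.trans_ne one_ne_zero)) h4]
  congr 1
  ring

/-- The exponent of the density of a pair of standard Gaussians with correlation `r` with respect
to an independent pair. -/
noncomputable def tiltExponent (r u v : ℝ) : ℝ :=
  r / (1 - r ^ 2) * (u * v) - r ^ 2 / (2 * (1 - r ^ 2)) * (u ^ 2 + v ^ 2)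

@[fun_prop]
theorem measurable_tiltExponent (r : ℝ) :
    Measurable fun z : ℝ × ℝ => tiltExponent r z.1 z.2 := by
  unfold tiltExponent; fun_prop

/-- The law of a pair of standard Gaussians with correlation `r`. -/
noncomputable def correlatedGaussian (r : ℝ) : Measure (ℝ × ℝ) :=
  ((gaussianReal 0 1).prod (gaussianReal 0 1)).map
    fun z => (z.1, r * z.1 + √(1 - r ^ 2) * z.2)

instance (r : ℝ) : IsProbabilityMeasure (correlatedGaussian r) := by
  unfold correlatedGaussian
  exact Measure.isProbabilityMeasure_map (by fun_prop)

/-- Conditionally on the first variable the second one is Gaussian with mean `r u` and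
variance `1 - r ^ 2`. -/
theorem map_gaussianReal_eq_withDensity {r : ℝ} (hr : |r| < 1) (u : ℝ) :
    (gaussianReal 0 1).map (fun w => r * u + √(1 - r ^ 2) * w)
      = (gaussianReal 0 1).withDensity fun v =>
          ENNReal.ofReal ((√(1 - r ^ 2))⁻¹ * Real.exp (tiltExponent r u v)) := by
  have hr2 : 0 < 1 - r ^ 2 := by
    have := (sq_lt_one_iff_abs_lt_one r).2 hr
    linarith
  have h1 : (gaussianReal 0 1).map (fun w => r * u + √(1 - r ^ 2) * w)
      = gaussianReal (r * u) (Real.toNNReal (1 - r ^ 2)) := by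
    have h2 : (fun w => r * u + √(1 - r ^ 2) * w)
        = (fun w => r * u + w) ∘ fun w => √(1 - r ^ 2) * w := rfl
    rw [h2, ← Measure.map_map (by fun_prop) (by fun_prop), gaussianReal_map_const_mul,
      gaussianReal_map_const_add]
    congr 1
    · simp
    · ext
      simp [Real.sq_sqrt hr2.le, hr2.le]
  have h3 : Real.toNNReal (1 - r ^ 2) ≠ 0 := by simpa using hr2
  rw [h1, gaussianReal_of_var_ne_zero _ h3, gaussianReal_of_var_ne_zero _ one_ne_zero,
    ← withDensity_mul _ (by fun_prop) (by unfold tiltExponent; fun_prop)]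
  congr 1
  funext v
  rw [Pi.mul_apply, gaussianPDF, gaussianPDF, ← ENNReal.ofReal_mul (gaussianPDFReal_nonneg _ _ _)]
  congr 1
  rw [gaussianPDFReal, gaussianPDFReal, Real.coe_toNNReal _ hr2.le, Real.sqrt_mul (by positivity),
    NNReal.coe_one, mul_one, mul_inv, mul_mul_mul_comm, ← Real.exp_add, mul_assoc, mul_assoc]
  congr 3
  rw [tiltExponent]
  field_simp
  ring

theorem correlatedGaussian_eq_withDensity {r : ℝ} (hr : |r| < 1) :
    correlatedGaussian r = ((gaussianReal 0 1).prod (gaussianReal 0 1)).withDensity fun z =>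
      ENNReal.ofReal ((√(1 - r ^ 2))⁻¹ * Real.exp (tiltExponent r z.1 z.2)) := by
  have hm : Measurable fun z : ℝ × ℝ =>
      ENNReal.ofReal ((√(1 - r ^ 2))⁻¹ * Real.exp (tiltExponent r z.1 z.2)) := by fun_prop
  refine Measure.ext_of_lintegral _ fun f hf => ?_
  rw [correlatedGaussian, lintegral_map hf (by fun_prop), lintegral_prod _ (by fun_prop),
    lintegral_withDensity_eq_lintegral_mul _ hm hf, lintegral_prod _ (by fun_prop)]
  refine lintegral_congr fun u => ?_
  have h1 := lintegral_map (μ := gaussianReal 0 1) (f := fun v => f (u, v))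
    (g := fun w => r * u + √(1 - r ^ 2) * w) (by fun_prop) (by fun_prop)
  rw [map_gaussianReal_eq_withDensity hr u,
    lintegral_withDensity_eq_lintegral_mul _ (by unfold tiltExponent; fun_prop) (by fun_prop)] at h1
  exact h1.symm

end Densities

/-! ### Diagonal Gaussian couplings as exponential tiltings of the product measure -/

section Tilting

variable {T d : ℕ}

/-- A family of pairs of reals, as one vector of two groups of coordinates. -/
noncomputable def pairVec (x : Fin T × Fin d → ℝ × ℝ) :
    EuclideanSpace ℝ ((Fin T × Fin d) ⊕ (Fin T × Fin d)) :=
  WithLp.toLp 2 (Sum.elim (fun p => (x p).1) fun p => (x p).2)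

@[fun_prop]
theorem measurable_pairVec : Measurable (pairVec (T := T) (d := d)) := by
  unfold pairVec
  refine (WithLp.measurable_toLp 2 _).comp (measurable_pi_lambda _ fun k => ?_)
  cases k <;> simp only [Sum.elim_inl, Sum.elim_inr] <;> fun_prop

theorem map_pairVec_pi :
    (Measure.pi fun _ : Fin T × Fin d => (gaussianReal 0 1).prod (gaussianReal 0 1)).map pairVec
      = multivariateGaussian 0 1 := by
  have h1 := (measurePreserving_arrowProdEquivProdArrow ℝ ℝ (Fin T × Fin d)
    (fun _ => gaussianReal 0 1) (fun _ => gaussianReal 0 1)).map_eq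
  have h2 := (measurePreserving_sumPiEquivProdPi_symm
    (fun _ : (Fin T × Fin d) ⊕ (Fin T × Fin d) => gaussianReal 0 1)).map_eq
  rw [multivariateGaussian_zero_one, ← map_pi_eq_stdGaussian, ← h2, ← h1,
    Measure.map_map (by fun_prop) (by fun_prop), Measure.map_map (by fun_prop) (by fun_prop)]
  congr 1

theorem map_pairVec_pi_correlatedGaussian {r : Fin T → Fin d → ℝ} (hr : ∀ t i, |r t i| ≤ 1) :
    (Measure.pi fun p : Fin T × Fin d => correlatedGaussian (r p.1 p.2)).map pairVec
      = multivariateGaussian 0 (pairCov (blockDiag fun t => Matrix.diagonal (r t))) := by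
  set c : Fin T × Fin d → ℝ := fun p => √(1 - r p.1 p.2 ^ 2) with hc
  have hR : blockDiag (fun t => Matrix.diagonal (r t)) = Matrix.diagonal fun p => r p.1 p.2 := by
    ext p q
    by_cases h : p.1 = q.1
    · by_cases h' : p.2 = q.2
      · simp [blockDiag, Prod.ext h h']
      · simp [blockDiag, h, h', Prod.ext_iff, Matrix.diagonal_apply]
    · simp [blockDiag, h, Prod.ext_iff, Matrix.diagonal_apply]
  set K := Matrix.fromBlocks (1 : BigMatrix T d) 0 (Matrix.diagonal fun p => r p.1 p.2)
    (Matrix.diagonal c) with hK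
  have hKK : K * 1 * K.transpose = pairCov (blockDiag fun t => Matrix.diagonal (r t)) := by
    have h1 : (fun p : Fin T × Fin d => r p.1 p.2 * r p.1 p.2 + c p * c p) = fun _ => 1 := by
      funext p
      have h2 : (0 : ℝ) ≤ 1 - r p.1 p.2 ^ 2 := by
        have := (sq_le_one_iff_abs_le_one (r p.1 p.2)).2 (hr p.1 p.2)
        linarith
      rw [hc, Real.mul_self_sqrt h2]
      ring
    rw [hR, pairCov, hK, mul_one, Matrix.fromBlocks_transpose, Matrix.fromBlocks_multiply]
    simp [Matrix.diagonal_transpose, Matrix.diagonal_mul_diagonal, h1]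
  have h1 := map_affine_multivariateGaussian 0
    (Matrix.PosSemidef.one (n := (Fin T × Fin d) ⊕ (Fin T × Fin d)) (R := ℝ)) K
  rw [hKK, ← map_pairVec_pi, Measure.map_map (by fun_prop) (by fun_prop)] at h1
  rw [← h1]
  have h2 := Measure.pi_map_pi
    (μ := fun _ : Fin T × Fin d => (gaussianReal 0 1).prod (gaussianReal 0 1))
    (f := fun p z => (z.1, r p.1 p.2 * z.1 + √(1 - r p.1 p.2 ^ 2) * z.2))
    (hμ := fun p => by
      have : IsProbabilityMeasure (correlatedGaussian (r p.1 p.2)) := inferInstance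
      unfold correlatedGaussian at this
      infer_instance) fun p => by fun_prop
  simp only [correlatedGaussian]
  rw [← h2, Measure.map_map (by fun_prop) (by fun_prop)]
  congr 1
  funext x
  have hx : (pairVec x).ofLp = Sum.elim (fun p => (x p).1) fun p => (x p).2 := rfl
  ext k
  rw [Function.comp_apply, Function.comp_apply, zero_add, Matrix.ofLp_toEuclideanCLM, hx, hK,
    Matrix.fromBlocks_mulVec]
  cases k <;> simp [pairVec, Matrix.mulVec_diagonal, hc]

variable {L M : BigMatrix T d} (a b : Path T d)

theorem prod_gaussian_eq_map :
    (gaussian a (L * L.transpose) : Measure (Path T d)).prod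
        (gaussian b (M * M.transpose) : Measure (Path T d))
      = (Measure.pi fun _ : Fin T × Fin d => (gaussianReal 0 1).prod (gaussianReal 0 1)).map
          fun x => colourPair L M a b (pairVec x) := by
  have h1 := (measurePreserving_arrowProdEquivProdArrow ℝ ℝ (Fin T × Fin d)
    (fun _ => gaussianReal 0 1) (fun _ => gaussianReal 0 1)).map_eq
  rw [gaussian_eq_map_colour, gaussian_eq_map_colour,
    Measure.map_prod_map _ _ (by fun_prop) (by fun_prop), multivariateGaussian_zero_one,
    ← map_pi_eq_stdGaussian, Measure.map_prod_map _ _ (by fun_prop) (by fun_prop), ← h1,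
    Measure.map_map (by fun_prop) (by fun_prop), Measure.map_map (by fun_prop) (by fun_prop)]
  rfl

/-- The sum over all coordinates of the exponents of the two-dimensional densities, in whitened
coordinates. -/
noncomputable def tiltPotential (L M : BigMatrix T d) (a b : Path T d) (r : Fin T → Fin d → ℝ)
    (z : Path T d × Path T d) : ℝ :=
  ∑ p : Fin T × Fin d, tiltExponent (r p.1 p.2) (whiten L a z.1 p) (whiten M b z.2 p)

@[fun_prop]
theorem measurable_tiltPotential (r : Fin T → Fin d → ℝ) :
    Measurable (tiltPotential L M a b r) := by
  unfold tiltPotential tiltExponent; fun_prop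

theorem gaussianCoupling_eq_tilted (hL : IsUnit L.det) (hM : IsUnit M.det)
    {r : Fin T → Fin d → ℝ} (hr : ∀ t i, |r t i| < 1) :
    Integrable (fun z => Real.exp (tiltPotential L M a b r z))
        ((gaussian a (L * L.transpose) : Measure (Path T d)).prod
          (gaussian b (M * M.transpose) : Measure (Path T d))) ∧
      (gaussianCoupling a b L M (fun t => Matrix.diagonal (r t)) :
          Measure (Path T d × Path T d))
        = ((gaussian a (L * L.transpose) : Measure (Path T d)).prod
          (gaussian b (M * M.transpose) : Measure (Path T d))).tilted
            (tiltPotential L M a b r) := by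
  have hpos (p : Fin T × Fin d) : 0 < (√(1 - r p.1 p.2 ^ 2))⁻¹ := by
    have := (sq_lt_one_iff_abs_lt_one (r p.1 p.2)).2 (hr p.1 p.2)
    exact inv_pos.2 (Real.sqrt_pos.2 (by linarith))
  have hC : 0 < ∏ p : Fin T × Fin d, (√(1 - r p.1 p.2 ^ 2))⁻¹ :=
    Finset.prod_pos fun p _ => hpos p
  refine withDensity_eq_tilted hC (by fun_prop) ?_
  rw [gaussianCoupling_eq_map_colourPair a b
    (fun t => isContraction_diagonal fun i => (hr t i).le),
    ← map_pairVec_pi_correlatedGaussian fun t i => (hr t i).le,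
    Measure.map_map (by fun_prop) (by fun_prop), prod_gaussian_eq_map,
    withDensity_map _ (by fun_prop) (by fun_prop)]
  simp only [fun p : Fin T × Fin d => correlatedGaussian_eq_withDensity (hr p.1 p.2)]
  have hsf (p : Fin T × Fin d) : SigmaFinite
      (((gaussianReal 0 1).prod (gaussianReal 0 1)).withDensity fun z =>
        ENNReal.ofReal ((√(1 - r p.1 p.2 ^ 2))⁻¹ *
          Real.exp (tiltExponent (r p.1 p.2) z.1 z.2))) := by
    rw [← correlatedGaussian_eq_withDensity (hr p.1 p.2)]
    infer_instance
  rw [pi_withDensity _ fun p => by fun_prop]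
  congr 2
  funext x
  rw [← ENNReal.ofReal_prod_of_nonneg fun p _ => by have := hpos p; positivity]
  congr 1
  rw [Finset.prod_mul_distrib, ← Real.exp_sum, tiltPotential]
  congr 3
  funext p
  have h1 := whitenPair_colourPair a b hL hM (pairVec x)
  have h2 : whiten L a (colourPair L M a b (pairVec x)).1 p = (x p).1 := by
    rw [← whitenPair_inl L M a b, h1]; rfl
  have h3 : whiten M b (colourPair L M a b (pairVec x)).2 p = (x p).2 := by
    rw [← whitenPair_inr L M a b, h1]; rfl
  rw [h2, h3]

end Tilting

/-! ### Cross covariances of bi-causal couplings -/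

section CrossCovariance

variable {T d : ℕ}

/-- Lower triangular factors for which the diagonal `d × d` blocks of `Mᵀ L` are the diagonal
matrices `diag(s_t)`. Multiplying Cholesky factors from the right by the orthogonal matrices of the
singular value decompositions brings them into this form. -/
structure AreDiagonalizingFactors (L M : BigMatrix T d) (s : Fin T → Fin d → ℝ) : Prop where
  lower_left : TimeLower L
  lower_right : TimeLower M
  isUnit_left : IsUnit L.det
  isUnit_right : IsUnit M.det
  nonneg : ∀ t i, 0 ≤ s t i
  diag : ∀ t i j, (M.transpose * L) (t, i) (t, j) = Matrix.diagonal (s t) i j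

/-- The covariance under `π` of a whitened coordinate of the first path and a whitened coordinate
of the second one. -/
noncomputable def crossCov (L M : BigMatrix T d) (a b : Path T d)
    (π : Measure (Path T d × Path T d)) : BigMatrix T d :=
  Matrix.of fun p q => cov[fun z => whiten L a z.1 p, fun z => whiten M b z.2 q; π]

variable {L M : BigMatrix T d} {a b : Path T d} {π : Measure (Path T d × Path T d)}

theorem map_whiten_fst (hL : IsUnit L.det)
    (h : π.fst = gaussian a (L * L.transpose)) :
    π.map (fun z => whiten L a z.1) = multivariateGaussian 0 1 := by
  rw [← map_whiten_gaussian a hL, ← h, Measure.fst, Measure.map_map (by fun_prop) (by fun_prop)]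
  rfl

theorem map_whiten_snd (hM : IsUnit M.det)
    (h : π.snd = gaussian b (M * M.transpose)) :
    π.map (fun z => whiten M b z.2) = multivariateGaussian 0 1 := by
  rw [← map_whiten_gaussian b hM, ← h, Measure.snd, Measure.map_map (by fun_prop) (by fun_prop)]
  rfl

theorem variance_eq_one_of_map_eq {Ω : Type*} [MeasurableSpace Ω] {P : Measure Ω}
    {X : Ω → Path T d} (h : P.map X = multivariateGaussian 0 1) (p : Fin T × Fin d) :
    Var[fun ω => X ω p; P] = 1 := by
  have hX := memLp_two_apply (hasGaussianLaw_of_map_eq h) p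
  rw [← covariance_self hX.aemeasurable,
    covariance_apply_of_map_eq h Matrix.PosSemidef.one, Matrix.one_apply_eq]

theorem integral_sq_of_map_eq {Ω : Type*} [MeasurableSpace Ω] {P : Measure Ω}
    [IsProbabilityMeasure P] {X : Ω → Path T d} (h : P.map X = multivariateGaussian 0 1)
    (p : Fin T × Fin d) : ∫ ω, X ω p ^ 2 ∂P = 1 := by
  have hX := memLp_two_apply (hasGaussianLaw_of_map_eq h) p
  have h1 := variance_eq_sub hX
  rw [variance_eq_one_of_map_eq h, integral_apply_of_map_eq h] at h1
  simpa using h1.symm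

variable [IsProbabilityMeasure π]

/-- The cross covariance between the blocks of any two standard Gaussian vectors is a
contraction, since `Var(x · u - y · v) ≥ 0`. -/
theorem isContraction_crossCov (hu : π.map (fun z => whiten L a z.1) = multivariateGaussian 0 1)
    (hv : π.map (fun z => whiten M b z.2) = multivariateGaussian 0 1) (t : Fin T) :
    IsContraction (block (crossCov L M a b π) t t) := by
  rw [isContraction_iff]
  intro x y
  have hu2 (i : Fin d) := memLp_two_apply (hasGaussianLaw_of_map_eq hu) (t, i)
  have hv2 (i : Fin d) := memLp_two_apply (hasGaussianLaw_of_map_eq hv) (t, i)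
  have hX : MemLp (fun z : Path T d × Path T d => ∑ i, x i * whiten L a z.1 (t, i)) 2 π :=
    memLp_finsetSum _ fun i _ => (hu2 i).const_mul _
  have hY : MemLp (fun z : Path T d × Path T d => ∑ i, y i * whiten M b z.2 (t, i)) 2 π :=
    memLp_finsetSum _ fun i _ => (hv2 i).const_mul _
  have h1 := variance_nonneg (fun z : Path T d × Path T d =>
    ∑ i, x i * whiten L a z.1 (t, i) - ∑ i, y i * whiten M b z.2 (t, i)) π
  have hcov {Z W : Fin d → Path T d × Path T d → ℝ} (hZ : ∀ i, MemLp (Z i) 2 π)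
      (hW : ∀ i, MemLp (W i) 2 π) (x y : Fin d → ℝ) :
      cov[fun z => ∑ i, x i * Z i z, fun z => ∑ j, y j * W j z; π]
        = x ⬝ᵥ (Matrix.of fun i j => cov[Z i, W j; π]).mulVec y := by
    rw [covariance_fun_sum_fun_sum (fun i => (hZ i).const_mul _) fun i => (hW i).const_mul _,
      dotProduct]
    refine Finset.sum_congr rfl fun i _ => ?_
    rw [Matrix.mulVec, dotProduct, Finset.mul_sum]
    refine Finset.sum_congr rfl fun j _ => ?_
    rw [covariance_const_mul_left, covariance_const_mul_right, Matrix.of_apply]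
    ring
  have hone {X : Path T d × Path T d → Path T d} (h : π.map X = multivariateGaussian 0 1) :
      (Matrix.of fun i j => cov[fun z => X z (t, i), fun z => X z (t, j); π])
        = (1 : Matrix (Fin d) (Fin d) ℝ) := by
    ext i j
    rw [Matrix.of_apply, covariance_apply_of_map_eq h Matrix.PosSemidef.one]
    simp [Matrix.one_apply]
  rw [variance_fun_sub hX hY, ← covariance_self hX.aemeasurable, ← covariance_self hY.aemeasurable,
    hcov hu2 hu2, hcov hv2 hv2, hcov hu2 hv2, hone hu, hone hv, Matrix.one_mulVec,
    Matrix.one_mulVec] at h1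
  have h2 : block (crossCov L M a b π) t t = Matrix.of fun i j =>
      cov[fun z => whiten L a z.1 (t, i), fun z => whiten M b z.2 (t, j); π] := rfl
  rw [h2]
  linarith

theorem crossCov_le_one (hu : π.map (fun z => whiten L a z.1) = multivariateGaussian 0 1)
    (hv : π.map (fun z => whiten M b z.2) = multivariateGaussian 0 1) (p : Fin T × Fin d) :
    crossCov L M a b π p p ≤ 1 := by
  have h1 := variance_nonneg (fun z : Path T d × Path T d =>
    whiten L a z.1 p - whiten M b z.2 p) π
  rw [variance_fun_sub (memLp_two_apply (hasGaussianLaw_of_map_eq hu) p)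
    (memLp_two_apply (hasGaussianLaw_of_map_eq hv) p), variance_eq_one_of_map_eq hu,
    variance_eq_one_of_map_eq hv] at h1
  rw [crossCov, Matrix.of_apply]
  linarith

theorem ae_eq_of_crossCov_eq_one
    (hu : π.map (fun z => whiten L a z.1) = multivariateGaussian 0 1)
    (hv : π.map (fun z => whiten M b z.2) = multivariateGaussian 0 1) {p : Fin T × Fin d}
    (h : crossCov L M a b π p p = 1) :
    ∀ᵐ z ∂π, whiten L a z.1 p = whiten M b z.2 p := by
  have hup := memLp_two_apply (hasGaussianLaw_of_map_eq hu) p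
  have hvp := memLp_two_apply (hasGaussianLaw_of_map_eq hv) p
  rw [crossCov, Matrix.of_apply] at h
  have h1 : Var[fun z : Path T d × Path T d => whiten L a z.1 p - whiten M b z.2 p; π] = 0 := by
    rw [variance_fun_sub hup hvp, variance_eq_one_of_map_eq hu, variance_eq_one_of_map_eq hv, h]
    norm_num
  have h2 := ae_eq_integral_of_variance_eq_zero (hup.sub hvp) h1
  filter_upwards [h2] with z hz
  rw [Pi.sub_apply] at hz
  simp only [Pi.sub_apply] at hz
  rw [integral_sub (hup.integrable one_le_two) (hvp.integrable one_le_two),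
    integral_apply_of_map_eq hu, integral_apply_of_map_eq hv] at hz
  simpa [sub_eq_zero] using hz

theorem integral_mul_eq_crossCov
    (hu : π.map (fun z => whiten L a z.1) = multivariateGaussian 0 1)
    (hv : π.map (fun z => whiten M b z.2) = multivariateGaussian 0 1) (p : Fin T × Fin d) :
    ∫ z, whiten L a z.1 p * whiten M b z.2 p ∂π = crossCov L M a b π p p := by
  rw [crossCov, Matrix.of_apply, covariance_eq_sub
    (memLp_two_apply (hasGaussianLaw_of_map_eq hu) p)
    (memLp_two_apply (hasGaussianLaw_of_map_eq hv) p), integral_apply_of_map_eq hu]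
  simp

/-- Bi-causality forces the cross covariance to be block diagonal: the later of two whitened
coordinates is independent of the joint past at its own time. -/
theorem crossCov_eq_zero_of_ne (hL : TimeLower L) (hLdet : IsUnit L.det) (hM : TimeLower M)
    (hMdet : IsUnit M.det) {π : ProbabilityMeasure (Path T d × Path T d)}
    (hπ : π ∈ bicausalCouplings (gaussian a (L * L.transpose)) (gaussian b (M * M.transpose)))
    {p q : Fin T × Fin d} (hpq : p.1 ≠ q.1) :
    crossCov L M a b (π : Measure (Path T d × Path T d)) p q = 0 := by
  obtain ⟨h1, h2, h3⟩ := (mem_bicausalCouplings_iff hL hLdet hM hMdet a b π).1 hπ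
  have hup := memLp_two_apply (hasGaussianLaw_of_map_eq (map_whiten_fst hLdet h1)) p
  have hvq := memLp_two_apply (hasGaussianLaw_of_map_eq (map_whiten_snd hMdet h2)) q
  rw [crossCov, Matrix.of_apply]
  rcases lt_or_gt_of_ne hpq with h | h
  · have h4 := (h3 q.1.val (by have := Fin.lt_def.1 h; omega) q.1.isLt).2
    have h5 := h4.comp (φ := fun w => whiten L a (glue q.1.val w.1 0) p)
      (by fun_prop)
      (measurable_pi_apply (X := fun _ : {s : Fin T // q.1.val ≤ s.val} × Fin d => ℝ)
        (⟨q.1, le_rfl⟩, q.2))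
    refine IndepFun.covariance_eq_zero ?_ hup hvq
    convert! h5 using 1
    funext z
    have h6 := congrFun (past_whiten (t := q.1.val) hL hLdet a
      (show past q.1.val z.1 = past q.1.val (glue q.1.val (past q.1.val z.1) 0) from
        (past_glue _ _ _).symm)) (⟨p.1, Fin.lt_def.1 h⟩, p.2)
    exact h6
  · have h4 := (h3 p.1.val (by have := Fin.lt_def.1 h; omega) p.1.isLt).1
    have h5 := h4.comp (φ := fun w => whiten M b (glue p.1.val w.2 0) q)
      (by fun_prop)
      (measurable_pi_apply (X := fun _ : {s : Fin T // p.1.val ≤ s.val} × Fin d => ℝ)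
        (⟨p.1, le_rfl⟩, p.2))
    refine IndepFun.covariance_eq_zero ?_ hup hvq
    refine IndepFun.symm ?_
    convert! h5 using 1
    funext z
    have h6 := congrFun (past_whiten (t := p.1.val) hM hMdet b
      (show past p.1.val z.2 = past p.1.val (glue p.1.val (past p.1.val z.2) 0) from
        (past_glue _ _ _).symm)) (⟨q.1, Fin.lt_def.1 h⟩, q.2)
    exact h6

theorem crossCov_gaussianCoupling (hL : IsUnit L.det) (hM : IsUnit M.det)
    {P : Fin T → Matrix (Fin d) (Fin d) ℝ} (hP : ∀ t, IsContraction (P t)) :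
    crossCov L M a b (gaussianCoupling a b L M P : Measure (Path T d × Path T d))
      = blockDiag P := by
  ext p q
  exact covariance_apply_of_map_eq (map_whitenPair_gaussianCoupling a b hL hM hP)
    (posSemidef_pairCov hP) (Sum.inl p) (Sum.inr q)

end CrossCovariance

/-! ### The quadratic cost -/

section QuadraticCost

variable {T d : ℕ} {L M : BigMatrix T d} {s : Fin T → Fin d → ℝ}

/-- The part of the quadratic cost that depends only on the marginals. -/
noncomputable def marginalCost (L M : BigMatrix T d) (a b : Path T d) : ℝ :=
  ∫ x, ‖x‖ ^ 2 ∂(gaussian a (L * L.transpose) : Measure (Path T d))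
    + ∫ y, ‖y‖ ^ 2 ∂(gaussian b (M * M.transpose) : Measure (Path T d)) - 2 * ∑ p, a p * b p

theorem apply_eq_whiten (hL : IsUnit L.det) (a x : Path T d) (p : Fin T × Fin d) :
    x p = a p + ∑ q, L p q * whiten L a x q := by
  conv_lhs => rw [← colour_whiten hL a x]
  rw [colour, PiLp.add_apply, toEuclideanCLM_apply_apply]

section Coordinates

variable {Ω : Type*} [MeasurableSpace Ω] {P : Measure Ω} {a b : Path T d}
  {X Y : Ω → Path T d}

theorem memLp_two_sum_whiten (N : BigMatrix T d)
    (h : P.map (fun ω => whiten L a (X ω)) = multivariateGaussian 0 1) (p : Fin T × Fin d) :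
    MemLp (fun ω => ∑ q, N p q * whiten L a (X ω) q) 2 P :=
  memLp_finsetSum _ fun q _ => (memLp_two_apply (hasGaussianLaw_of_map_eq h) q).const_mul _

variable [IsProbabilityMeasure P]

theorem memLp_two_of_map_whiten (hL : IsUnit L.det)
    (h : P.map (fun ω => whiten L a (X ω)) = multivariateGaussian 0 1) (p : Fin T × Fin d) :
    MemLp (fun ω => X ω p) 2 P := by
  have h1 : (fun ω => X ω p) = fun ω => a p + ∑ q, L p q * whiten L a (X ω) q :=
    funext fun ω => apply_eq_whiten hL a (X ω) p
  rw [h1]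
  have h2 : MemLp (fun _ : Ω => a p) 2 P := memLp_const (a p)
  exact h2.add (memLp_two_sum_whiten L h p)

theorem integral_of_map_whiten (hL : IsUnit L.det)
    (h : P.map (fun ω => whiten L a (X ω)) = multivariateGaussian 0 1) (p : Fin T × Fin d) :
    ∫ ω, X ω p ∂P = a p := by
  have h2 (q : Fin T × Fin d) : Integrable (fun ω => L p q * whiten L a (X ω) q) P :=
    ((memLp_two_apply (hasGaussianLaw_of_map_eq h) q).integrable one_le_two).const_mul _
  have h3 (q : Fin T × Fin d) : ∫ ω, L p q * whiten L a (X ω) q ∂P = 0 := by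
    rw [integral_const_mul, integral_apply_of_map_eq h]
    simp
  have h1 : (fun ω => X ω p) = fun ω => a p + ∑ q, L p q * whiten L a (X ω) q :=
    funext fun ω => apply_eq_whiten hL a (X ω) p
  rw [h1, integral_add (integrable_const _) (integrable_finsetSum _ fun q _ => h2 q),
    integral_finsetSum _ fun q _ => h2 q, Finset.sum_eq_zero fun q _ => h3 q, integral_const]
  simp

theorem integral_mul_of_map_whiten (hL : IsUnit L.det) (hM : IsUnit M.det)
    (hX : P.map (fun ω => whiten L a (X ω)) = multivariateGaussian 0 1)
    (hY : P.map (fun ω => whiten M b (Y ω)) = multivariateGaussian 0 1) (p : Fin T × Fin d) :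
    ∫ ω, X ω p * Y ω p ∂P = a p * b p + ∑ q, ∑ r, L p q * (M p r *
      cov[fun ω => whiten L a (X ω) q, fun ω => whiten M b (Y ω) r; P]) := by
  have h3 := covariance_eq_sub (memLp_two_of_map_whiten hL hX p)
    (memLp_two_of_map_whiten hM hY p)
  rw [integral_of_map_whiten hL hX, integral_of_map_whiten hM hY] at h3
  have h4 : cov[fun ω => X ω p, fun ω => Y ω p; P] = ∑ q, ∑ r, L p q * (M p r *
      cov[fun ω => whiten L a (X ω) q, fun ω => whiten M b (Y ω) r; P]) := by
    rw [funext fun ω => apply_eq_whiten hL a (X ω) p, funext fun ω => apply_eq_whiten hM b (Y ω) p,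
      covariance_const_add_left ((memLp_two_sum_whiten L hX p).integrable one_le_two),
      covariance_const_add_right ((memLp_two_sum_whiten M hY p).integrable one_le_two),
      covariance_fun_sum_fun_sum
        (fun q => (memLp_two_apply (hasGaussianLaw_of_map_eq hX) q).const_mul _)
        fun q => (memLp_two_apply (hasGaussianLaw_of_map_eq hY) q).const_mul _]
    refine Finset.sum_congr rfl fun q _ => Finset.sum_congr rfl fun r _ => ?_
    rw [covariance_const_mul_left, covariance_const_mul_right]
  rw [← h4, h3]
  exact (add_sub_cancel _ _).symm

end Coordinates

/-- The trace of `L C Mᵀ` for a block diagonal matrix `C` only sees the diagonal of `C`. -/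
theorem AreDiagonalizingFactors.sum_mul_eq (h : AreDiagonalizingFactors L M s) {C : BigMatrix T d}
    (hC : ∀ p q, p.1 ≠ q.1 → C p q = 0) :
    ∑ p, ∑ q, ∑ r, L p q * (M p r * C q r) = ∑ p : Fin T × Fin d, s p.1 p.2 * C p p := by
  have h3 : ∑ p, ∑ q, ∑ r, L p q * (M p r * C q r)
      = ∑ q, ∑ r, (M.transpose * L) r q * C q r := by
    rw [Finset.sum_comm]
    refine Finset.sum_congr rfl fun q _ => ?_
    rw [Finset.sum_comm]
    refine Finset.sum_congr rfl fun r _ => ?_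
    rw [Matrix.mul_apply, Finset.sum_mul]
    refine Finset.sum_congr rfl fun p _ => ?_
    rw [Matrix.transpose_apply]
    ring
  rw [h3]
  refine Finset.sum_congr rfl fun q _ => ?_
  rw [Finset.sum_eq_single q]
  · rw [h.diag q.1 q.2 q.2, Matrix.diagonal_apply_eq]
  · intro r _ hr
    by_cases hqr : q.1 = r.1
    · have h4 : r = (q.1, r.2) := Prod.ext hqr.symm rfl
      have h5 : r.2 ≠ q.2 := fun h' => hr (Prod.ext hqr.symm h')
      have h6 := h.diag q.1 r.2 q.2
      rw [← h4, Matrix.diagonal_apply_ne _ h5] at h6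
      rw [h6, zero_mul]
    · rw [hC q r hqr, mul_zero]
  · simp

/-- The quadratic cost of a bi-causal coupling is an affine function of the diagonal of its
cross covariance matrix. -/
theorem integral_norm_sub_sq (h : AreDiagonalizingFactors L M s) {a b : Path T d}
    {π : ProbabilityMeasure (Path T d × Path T d)}
    (hπ : π ∈ bicausalCouplings (gaussian a (L * L.transpose)) (gaussian b (M * M.transpose))) :
    Integrable (fun z : Path T d × Path T d => ‖z.1 - z.2‖ ^ 2)
        (π : Measure (Path T d × Path T d)) ∧
      ∫ z, ‖z.1 - z.2‖ ^ 2 ∂(π : Measure (Path T d × Path T d))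
        = marginalCost L M a b - 2 * ∑ p : Fin T × Fin d,
          s p.1 p.2 * crossCov L M a b (π : Measure (Path T d × Path T d)) p p := by
  have h1 : (π : Measure (Path T d × Path T d)).fst = gaussian a (L * L.transpose) := hπ.1
  have h2 : (π : Measure (Path T d × Path T d)).snd = gaussian b (M * M.transpose) := hπ.2.1
  have hu := map_whiten_fst h.isUnit_left h1
  have hv := map_whiten_snd h.isUnit_right h2
  have hx2 := memLp_two_of_map_whiten h.isUnit_left hu
  have hy2 := memLp_two_of_map_whiten h.isUnit_right hv
  have hxy : ∑ p, ∫ z, z.1 p * z.2 p ∂(π : Measure (Path T d × Path T d))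
      = ∑ p, a p * b p + ∑ p : Fin T × Fin d,
        s p.1 p.2 * crossCov L M a b (π : Measure (Path T d × Path T d)) p p := by
    rw [← h.sum_mul_eq fun p q => crossCov_eq_zero_of_ne h.lower_left h.isUnit_left h.lower_right
      h.isUnit_right hπ, ← Finset.sum_add_distrib]
    exact Finset.sum_congr rfl fun p _ =>
      integral_mul_of_map_whiten h.isUnit_left h.isUnit_right hu hv p
  have hnx : Integrable (fun z : Path T d × Path T d => ‖z.1‖ ^ 2)
      (π : Measure (Path T d × Path T d)) := by
    simp only [EuclideanSpace.real_norm_sq_eq]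
    exact integrable_finsetSum _ fun p _ => (hx2 p).integrable_sq
  have hny : Integrable (fun z : Path T d × Path T d => ‖z.2‖ ^ 2)
      (π : Measure (Path T d × Path T d)) := by
    simp only [EuclideanSpace.real_norm_sq_eq]
    exact integrable_finsetSum _ fun p _ => (hy2 p).integrable_sq
  have hin : Integrable (fun z : Path T d × Path T d => 2 * ∑ p, z.1 p * z.2 p)
      (π : Measure (Path T d × Path T d)) :=
    (integrable_finsetSum _ fun p _ => (hx2 p).integrable_mul (hy2 p)).const_mul 2
  have hexp : (fun z : Path T d × Path T d => ‖z.1 - z.2‖ ^ 2)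
      = fun z => ‖z.1‖ ^ 2 + ‖z.2‖ ^ 2 - 2 * ∑ p, z.1 p * z.2 p := by
    funext z
    rw [norm_sub_sq_real, PiLp.inner_apply]
    simp only [RCLike.inner_apply, conj_trivial]
    rw [Finset.sum_congr rfl fun p _ => mul_comm (z.2 p) (z.1 p)]
    ring
  rw [hexp]
  refine ⟨(hnx.add hny).sub hin, ?_⟩
  refine (integral_sub (hnx.add hny) hin).trans ?_
  rw [integral_add' hnx hny, integral_const_mul,
    integral_finsetSum Finset.univ (f := fun p (z : Path T d × Path T d) => z.1 p * z.2 p)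
      fun p _ => (hx2 p).integrable_mul (hy2 p), hxy, marginalCost, ← h1, ← h2,
    Measure.fst, Measure.snd, integral_map (by fun_prop) (by fun_prop),
    integral_map (by fun_prop) (by fun_prop)]
  ring

theorem lintegral_norm_sub_sq (h : AreDiagonalizingFactors L M s) {a b : Path T d}
    {π : ProbabilityMeasure (Path T d × Path T d)}
    (hπ : π ∈ bicausalCouplings (gaussian a (L * L.transpose)) (gaussian b (M * M.transpose))) :
    0 ≤ marginalCost L M a b - 2 * ∑ p : Fin T × Fin d,
          s p.1 p.2 * crossCov L M a b (π : Measure (Path T d × Path T d)) p p ∧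
      ∫⁻ z, ENNReal.ofReal (‖z.1 - z.2‖ ^ 2) ∂(π : Measure (Path T d × Path T d))
        = ENNReal.ofReal (marginalCost L M a b - 2 * ∑ p : Fin T × Fin d,
          s p.1 p.2 * crossCov L M a b (π : Measure (Path T d × Path T d)) p p) := by
  obtain ⟨h1, h2⟩ := integral_norm_sub_sq h hπ
  rw [← h2]
  exact ⟨integral_nonneg fun z => by positivity,
    (ofReal_integral_eq_lintegral_ofReal h1 (ae_of_all _ fun z => by positivity)).symm⟩

end QuadraticCost

/-! ### Relative entropy and exponential tilting -/

section RelativeEntropy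

open InformationTheory

variable {α : Type*} [MeasurableSpace α] {m ρ : Measure α} [IsProbabilityMeasure m] {q : α → ℝ}

theorem toReal_klDiv_eq_tilted [IsProbabilityMeasure ρ]
    (hexp : Integrable (fun x => Real.exp (q x)) m) (hq : Integrable q ρ) (h : klDiv ρ m ≠ ⊤) :
    klDiv ρ (m.tilted q) ≠ ⊤ ∧ (klDiv ρ m).toReal
      = (klDiv ρ (m.tilted q)).toReal + ∫ x, q x ∂ρ - Real.log (∫ x, Real.exp (q x) ∂m) := by
  obtain ⟨hac, hint⟩ := klDiv_ne_top_iff.1 h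
  have hac' : ρ ≪ m.tilted q := hac.trans (absolutelyContinuous_tilted hexp)
  have := isProbabilityMeasure_tilted hexp
  refine ⟨klDiv_ne_top hac' (integrable_llr_tilted_right hac hq hint hexp), ?_⟩
  rw [toReal_klDiv_of_measure_eq hac (by simp), toReal_klDiv_of_measure_eq hac' (by simp),
    integral_llr_tilted_right hac hq hexp hint]
  ring

theorem klDiv_tilted_ne_top (hexp : Integrable (fun x => Real.exp (q x)) m)
    (hq : Integrable q (m.tilted q)) : klDiv (m.tilted q) m ≠ ⊤ := by
  have := isProbabilityMeasure_tilted hexp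
  have hac := tilted_absolutelyContinuous m q
  refine klDiv_ne_top hac ?_
  have h : llr (m.tilted q) m =ᵐ[m.tilted q]
      fun x => q x - Real.log (∫ x, Real.exp (q x) ∂m) :=
    hac.ae_le (log_rnDeriv_tilted_left_self hexp)
  exact (hq.sub (integrable_const (Real.log (∫ x, Real.exp (q x) ∂m)))).congr h.symm

end RelativeEntropy

/-! ### The entropic problem -/

section Entropic

open InformationTheory

variable {T d : ℕ} {L M : BigMatrix T d} {s : Fin T → Fin d → ℝ} {a b : Path T d}

/-- The number `r = shrink lam x` solves `lam r / (1 - r ^ 2) = 2 x`, which is the first order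
condition for the correlation of an optimizer. -/
theorem shrink_spec {lam x : ℝ} (hlam : 0 < lam) (hx : 0 ≤ x) :
    |shrink lam x| < 1 ∧
      lam * (shrink lam x / (1 - shrink lam x ^ 2)) = 2 * x := by
  rcases hx.eq_or_lt with rfl | hx
  · simp [shrink]
  set k := lam / (4 * x) with hk
  have hk0 : 0 < k := by positivity
  have hr : shrink lam x = √(k ^ 2 + 1) - k := by
    rw [shrink, if_neg hx.ne', Real.sign_of_pos hx, abs_of_pos hx, one_mul]
  have hsq : √(k ^ 2 + 1) ^ 2 = k ^ 2 + 1 := Real.sq_sqrt (by positivity)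
  have h1 : k < √(k ^ 2 + 1) := Real.lt_sqrt_of_sq_lt (by linarith)
  have h2 : √(k ^ 2 + 1) < k + 1 := (Real.sqrt_lt' (by linarith)).2 (by nlinarith)
  have h3 : 1 - shrink lam x ^ 2 = 2 * k * shrink lam x := by
    rw [hr]; linear_combination -hsq
  have h4 : 0 < shrink lam x := by rw [hr]; linarith
  refine ⟨abs_lt.2 ⟨by linarith, by rw [hr]; linarith⟩, ?_⟩
  rw [h3, hk]
  field_simp
  ring

theorem integral_tiltPotential {π : Measure (Path T d × Path T d)} [IsProbabilityMeasure π]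
    (hu : π.map (fun z => whiten L a z.1) = multivariateGaussian 0 1)
    (hv : π.map (fun z => whiten M b z.2) = multivariateGaussian 0 1) (r : Fin T → Fin d → ℝ) :
    Integrable (tiltPotential L M a b r) π ∧ ∫ z, tiltPotential L M a b r z ∂π
      = ∑ p : Fin T × Fin d, (r p.1 p.2 / (1 - r p.1 p.2 ^ 2) * crossCov L M a b π p p
        - r p.1 p.2 ^ 2 / (1 - r p.1 p.2 ^ 2)) := by
  have hu2 := memLp_two_apply (hasGaussianLaw_of_map_eq hu)
  have hv2 := memLp_two_apply (hasGaussianLaw_of_map_eq hv)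
  have h1 (p : Fin T × Fin d) : Integrable (fun z : Path T d × Path T d =>
      r p.1 p.2 / (1 - r p.1 p.2 ^ 2) * (whiten L a z.1 p * whiten M b z.2 p)) π :=
    ((hu2 p).integrable_mul (hv2 p)).const_mul _
  have h2 (p : Fin T × Fin d) : Integrable (fun z : Path T d × Path T d =>
      whiten L a z.1 p ^ 2 + whiten M b z.2 p ^ 2) π :=
    (hu2 p).integrable_sq.add (hv2 p).integrable_sq
  have h3 (p : Fin T × Fin d) : Integrable (fun z : Path T d × Path T d =>
      tiltExponent (r p.1 p.2) (whiten L a z.1 p) (whiten M b z.2 p)) π :=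
    (h1 p).sub ((h2 p).const_mul _)
  refine ⟨integrable_finsetSum _ fun p _ => h3 p, ?_⟩
  refine (integral_finsetSum _ fun p _ => h3 p).trans (Finset.sum_congr rfl fun p _ => ?_)
  refine (integral_sub (h1 p) ((h2 p).const_mul _)).trans ?_
  rw [integral_const_mul, integral_const_mul, integral_mul_eq_crossCov hu hv,
    integral_add (hu2 p).integrable_sq (hv2 p).integrable_sq, integral_sq_of_map_eq hu,
    integral_sq_of_map_eq hv]
  congr 1
  rw [div_mul_eq_mul_div, mul_comm 2 (1 - r p.1 p.2 ^ 2), one_add_one_eq_two]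
  exact mul_div_mul_right _ _ two_ne_zero

theorem IsOptimizer.le {lam : ℝ} {μ ν : ProbabilityMeasure (Path T d)}
    {π ρ : ProbabilityMeasure (Path T d × Path T d)} (h : IsOptimizer lam μ ν π)
    (hρ : ρ ∈ bicausalCouplings μ ν) : entropicCost lam μ ν π ≤ entropicCost lam μ ν ρ :=
  h.2.trans_le (iInf₂_le ρ hρ)

theorem isOptimizer_of_forall_le {lam : ℝ} {μ ν : ProbabilityMeasure (Path T d)}
    {π : ProbabilityMeasure (Path T d × Path T d)} (hπ : π ∈ bicausalCouplings μ ν)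
    (h : ∀ ρ ∈ bicausalCouplings μ ν, entropicCost lam μ ν π ≤ entropicCost lam μ ν ρ) :
    IsOptimizer lam μ ν π :=
  ⟨hπ, le_antisymm (le_iInf₂ h) (iInf₂_le π hπ)⟩

/-- For a regularization by relative entropy the cost of a bi-causal coupling exceeds a constant
by `lam` times its relative entropy with respect to the candidate optimizer: the linear terms of
the quadratic cost and of the exponent of the density of the candidate cancel. -/
theorem AreDiagonalizingFactors.exists_entropicCost_eq (h : AreDiagonalizingFactors L M s)
    {lam : ℝ} (hlam : 0 < lam) (a b : Path T d) :
    ∃ C : ℝ, ∀ ρ ∈ bicausalCouplings (gaussian a (L * L.transpose))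
        (gaussian b (M * M.transpose)),
      entropicCost lam (gaussian a (L * L.transpose)) (gaussian b (M * M.transpose)) ρ ≠ ⊤ →
      klDiv (ρ : Measure (Path T d × Path T d)) (gaussianCoupling a b L M fun t =>
          Matrix.diagonal fun i => shrink lam (s t i) : Measure (Path T d × Path T d)) ≠ ⊤ ∧
        0 ≤ C + lam * (klDiv (ρ : Measure (Path T d × Path T d)) (gaussianCoupling a b L M fun t =>
          Matrix.diagonal fun i => shrink lam (s t i) : Measure (Path T d × Path T d))).toReal ∧
        entropicCost lam (gaussian a (L * L.transpose)) (gaussian b (M * M.transpose)) ρ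
          = ENNReal.ofReal (C + lam * (klDiv (ρ : Measure (Path T d × Path T d))
            (gaussianCoupling a b L M fun t =>
              Matrix.diagonal fun i => shrink lam (s t i) :
                Measure (Path T d × Path T d))).toReal) := by
  have hr (t : Fin T) (i : Fin d) := shrink_spec hlam (h.nonneg t i)
  obtain ⟨hexp, htilt⟩ := gaussianCoupling_eq_tilted (a := a) (b := b) h.isUnit_left
    h.isUnit_right (r := fun t i => shrink lam (s t i)) fun t i => (hr t i).1
  refine ⟨marginalCost L M a b - lam * ∑ p : Fin T × Fin d,
      shrink lam (s p.1 p.2) ^ 2 / (1 - shrink lam (s p.1 p.2) ^ 2)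
    - lam * Real.log (∫ z, Real.exp (tiltPotential L M a b (fun t i => shrink lam (s t i)) z)
        ∂((gaussian a (L * L.transpose) : Measure (Path T d)).prod
          (gaussian b (M * M.transpose) : Measure (Path T d)))), fun ρ hρ hfin => ?_⟩
  have hkl : klDiv (ρ : Measure (Path T d × Path T d))
      ((gaussian a (L * L.transpose) : Measure (Path T d)).prod
        (gaussian b (M * M.transpose) : Measure (Path T d))) ≠ ⊤ := by
    intro htop
    refine hfin ?_
    rw [entropicCost, htop, ENNReal.mul_top (ENNReal.ofReal_pos.2 hlam).ne', add_top]
  obtain ⟨hq, hqint⟩ := integral_tiltPotential (map_whiten_fst h.isUnit_left hρ.1)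
    (map_whiten_snd h.isUnit_right hρ.2.1) fun t i => shrink lam (s t i)
  obtain ⟨hkl', hid⟩ := toReal_klDiv_eq_tilted hexp hq hkl
  obtain ⟨hJ, hcost⟩ := lintegral_norm_sub_sq h hρ
  rw [← htilt] at hkl' hid
  have hlin : lam * ∫ z, tiltPotential L M a b (fun t i => shrink lam (s t i)) z
        ∂(ρ : Measure (Path T d × Path T d))
      = 2 * ∑ p : Fin T × Fin d,
          s p.1 p.2 * crossCov L M a b (ρ : Measure (Path T d × Path T d)) p p
        - lam * ∑ p : Fin T × Fin d,
          shrink lam (s p.1 p.2) ^ 2 / (1 - shrink lam (s p.1 p.2) ^ 2) := by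
    rw [hqint, Finset.sum_sub_distrib, mul_sub]
    congr 1
    rw [Finset.mul_sum, Finset.mul_sum]
    refine Finset.sum_congr rfl fun p _ => ?_
    rw [← mul_assoc, (hr p.1 p.2).2, mul_assoc]
  have hnn : 0 ≤ lam * (klDiv (ρ : Measure (Path T d × Path T d))
      ((gaussian a (L * L.transpose) : Measure (Path T d)).prod
        (gaussian b (M * M.transpose) : Measure (Path T d)))).toReal := by positivity
  have hsum := add_nonneg hJ hnn
  have hcost' : entropicCost lam (gaussian a (L * L.transpose)) (gaussian b (M * M.transpose)) ρ
      = ENNReal.ofReal (marginalCost L M a b - 2 * ∑ p : Fin T × Fin d,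
          s p.1 p.2 * crossCov L M a b (ρ : Measure (Path T d × Path T d)) p p
        + lam * (klDiv (ρ : Measure (Path T d × Path T d))
          ((gaussian a (L * L.transpose) : Measure (Path T d)).prod
            (gaussian b (M * M.transpose) : Measure (Path T d)))).toReal) := by
    rw [ENNReal.ofReal_add hJ hnn, entropicCost, hcost, ENNReal.ofReal_mul hlam.le,
      ENNReal.ofReal_toReal hkl]
  rw [hid] at hsum hcost'
  refine ⟨hkl', ?_, ?_⟩
  · linear_combination hsum + hlin
  · rw [hcost']
    congr 1
    linear_combination hlin

theorem AreDiagonalizingFactors.isUniqueOptimizer (h : AreDiagonalizingFactors L M s)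
    {lam : ℝ} (hlam : 0 < lam) (a b : Path T d) :
    IsUniqueOptimizer lam (gaussian a (L * L.transpose)) (gaussian b (M * M.transpose))
      (gaussianCoupling a b L M fun t => Matrix.diagonal fun i => shrink lam (s t i)) := by
  obtain ⟨C, hC⟩ := h.exists_entropicCost_eq hlam a b
  have hr (t : Fin T) (i : Fin d) := shrink_spec hlam (h.nonneg t i)
  have hmem := gaussianCoupling_mem_bicausalCouplings a b h.lower_left h.isUnit_left
    h.lower_right h.isUnit_right fun t => isContraction_diagonal fun i => (hr t i).1.le
  have hfin : entropicCost lam (gaussian a (L * L.transpose)) (gaussian b (M * M.transpose))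
      (gaussianCoupling a b L M fun t => Matrix.diagonal fun i => shrink lam (s t i)) ≠ ⊤ := by
    obtain ⟨hexp, htilt⟩ := gaussianCoupling_eq_tilted (a := a) (b := b) h.isUnit_left
      h.isUnit_right (r := fun t i => shrink lam (s t i)) fun t i => (hr t i).1
    obtain ⟨hq, -⟩ := integral_tiltPotential (map_whiten_fst h.isUnit_left hmem.1)
      (map_whiten_snd h.isUnit_right hmem.2.1) fun t i => shrink lam (s t i)
    rw [htilt] at hq
    have hkl := klDiv_tilted_ne_top hexp hq
    rw [← htilt] at hkl
    rw [entropicCost, (lintegral_norm_sub_sq h hmem).2]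
    exact ENNReal.add_ne_top.2 ⟨ENNReal.ofReal_ne_top,
      ENNReal.mul_ne_top ENNReal.ofReal_ne_top hkl⟩
  obtain ⟨-, h0, hcost⟩ := hC _ hmem hfin
  rw [klDiv_self, ENNReal.toReal_zero, mul_zero, add_zero] at h0 hcost
  have hopt := isOptimizer_of_forall_le (lam := lam) hmem fun ρ hρ => by
    by_cases htop : entropicCost lam (gaussian a (L * L.transpose))
        (gaussian b (M * M.transpose)) ρ = ⊤
    · rw [htop]; exact le_top
    · obtain ⟨-, -, h2⟩ := hC ρ hρ htop
      rw [hcost, h2]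
      exact ENNReal.ofReal_le_ofReal (le_add_of_nonneg_right (by positivity))
  refine ⟨hopt, fun ρ hρ => ?_⟩
  have heq := hρ.2.trans hopt.2.symm
  obtain ⟨h1, h2, h3⟩ := hC ρ hρ.1 (heq ▸ hfin)
  rw [h3, hcost, ENNReal.ofReal_eq_ofReal_iff h2 h0, add_eq_left, mul_eq_zero,
    or_iff_right hlam.ne', ENNReal.toReal_eq_zero_iff, or_iff_left h1, klDiv_eq_zero_iff] at heq
  exact Subtype.ext heq

end Entropic

/-! ### The problem without regularization -/

section Unregularized

variable {T d : ℕ} {L M : BigMatrix T d} {s : Fin T → Fin d → ℝ} {a b : Path T d}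

theorem AreDiagonalizingFactors.entropicCost_zero (h : AreDiagonalizingFactors L M s)
    {π : ProbabilityMeasure (Path T d × Path T d)}
    (hπ : π ∈ bicausalCouplings (gaussian a (L * L.transpose)) (gaussian b (M * M.transpose))) :
    entropicCost 0 (gaussian a (L * L.transpose)) (gaussian b (M * M.transpose)) π
      = ENNReal.ofReal (marginalCost L M a b - 2 * ∑ p : Fin T × Fin d,
        s p.1 p.2 * crossCov L M a b (π : Measure (Path T d × Path T d)) p p) := by
  rw [entropicCost, (lintegral_norm_sub_sq h hπ).2, ENNReal.ofReal_zero, zero_mul, add_zero]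

/-- Without regularization a bi-causal coupling is optimal if and only if the whitened coordinates
with non-zero singular value have correlation one. -/
theorem AreDiagonalizingFactors.isOptimizer_zero_iff (h : AreDiagonalizingFactors L M s)
    (a b : Path T d) (π : ProbabilityMeasure (Path T d × Path T d)) :
    IsOptimizer 0 (gaussian a (L * L.transpose)) (gaussian b (M * M.transpose)) π ↔
      π ∈ bicausalCouplings (gaussian a (L * L.transpose)) (gaussian b (M * M.transpose)) ∧
      ∀ t i, s t i ≠ 0 →
        crossCov L M a b (π : Measure (Path T d × Path T d)) (t, i) (t, i) = 1 := by
  have hle {ρ : ProbabilityMeasure (Path T d × Path T d)}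
      (hρ : ρ ∈ bicausalCouplings (gaussian a (L * L.transpose)) (gaussian b (M * M.transpose)))
      (p : Fin T × Fin d) :
      s p.1 p.2 * crossCov L M a b (ρ : Measure (Path T d × Path T d)) p p ≤ s p.1 p.2 :=
    mul_le_of_le_one_right (h.nonneg _ _) (crossCov_le_one (map_whiten_fst h.isUnit_left hρ.1)
      (map_whiten_snd h.isUnit_right hρ.2.1) p)
  constructor
  · intro hπ
    refine ⟨hπ.1, fun t i hti => ?_⟩
    have hP (t : Fin T) : IsContraction (Matrix.diagonal fun _ : Fin d => (1 : ℝ)) :=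
      isContraction_diagonal fun i => by simp
    have hmem := gaussianCoupling_mem_bicausalCouplings a b h.lower_left h.isUnit_left
      h.lower_right h.isUnit_right hP
    have h1 := hπ.le hmem
    rw [h.entropicCost_zero hπ.1, h.entropicCost_zero hmem,
      ENNReal.ofReal_le_ofReal_iff (lintegral_norm_sub_sq h hmem).1,
      crossCov_gaussianCoupling h.isUnit_left h.isUnit_right hP] at h1
    have h2 : ∑ p : Fin T × Fin d, s p.1 p.2 * blockDiag
        (fun _ : Fin T => Matrix.diagonal fun _ : Fin d => (1 : ℝ)) p p
          = ∑ p : Fin T × Fin d, s p.1 p.2 :=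
      Finset.sum_congr rfl fun p _ => by simp [blockDiag]
    rw [h2] at h1
    have h3 := (Finset.sum_eq_sum_iff_of_le fun p _ => hle hπ.1 p).1
      (le_antisymm (Finset.sum_le_sum fun p _ => hle hπ.1 p) (by linarith)) (t, i)
      (Finset.mem_univ _)
    exact (mul_eq_left₀ hti).1 h3
  · rintro ⟨hπ, h1⟩
    refine isOptimizer_of_forall_le hπ fun ρ hρ => ?_
    rw [h.entropicCost_zero hπ, h.entropicCost_zero hρ]
    refine ENNReal.ofReal_le_ofReal ?_
    have h2 : ∑ p : Fin T × Fin d,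
        s p.1 p.2 * crossCov L M a b (π : Measure (Path T d × Path T d)) p p
          = ∑ p : Fin T × Fin d, s p.1 p.2 := by
      refine Finset.sum_congr rfl fun p _ => ?_
      by_cases hp : s p.1 p.2 = 0
      · rw [hp, zero_mul]
      · rw [show crossCov L M a b (π : Measure (Path T d × Path T d)) p p = 1 from
          h1 p.1 p.2 hp, mul_one]
    rw [h2]
    have h3 := Finset.sum_le_sum fun p (_ : p ∈ Finset.univ) => hle hρ p
    linarith

theorem AreDiagonalizingFactors.isOptimizer_zero_gaussianCoupling
    (h : AreDiagonalizingFactors L M s) (a b : Path T d)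
    {D : Fin T → Matrix (Fin d) (Fin d) ℝ}
    (hD : ∀ t, IsContraction (D t) ∧ ∀ i, s t i ≠ 0 → D t i i = 1) :
    IsOptimizer 0 (gaussian a (L * L.transpose)) (gaussian b (M * M.transpose))
      (gaussianCoupling a b L M D) := by
  refine (h.isOptimizer_zero_iff a b _).2 ⟨gaussianCoupling_mem_bicausalCouplings a b h.lower_left
    h.isUnit_left h.lower_right h.isUnit_right fun t => (hD t).1, fun t i hti => ?_⟩
  rw [crossCov_gaussianCoupling h.isUnit_left h.isUnit_right fun t => (hD t).1]
  simpa [blockDiag] using (hD t).2 i hti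

/-- If all singular values are positive, then under an optimizer the whitened paths agree, so that
the second path is a function of the first one. -/
theorem AreDiagonalizingFactors.eq_map_of_isOptimizer_zero (h : AreDiagonalizingFactors L M s)
    (hs : ∀ t i, s t i ≠ 0) {π : ProbabilityMeasure (Path T d × Path T d)}
    (hπ : IsOptimizer 0 (gaussian a (L * L.transpose)) (gaussian b (M * M.transpose)) π) :
    (π : Measure (Path T d × Path T d))
      = (gaussian a (L * L.transpose) : Measure (Path T d)).map
        fun x => (x, colour M b (whiten L a x)) := by
  obtain ⟨hmem, hc⟩ := (h.isOptimizer_zero_iff a b π).1 hπ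
  have hae : ∀ᵐ z ∂(π : Measure (Path T d × Path T d)), whiten L a z.1 = whiten M b z.2 := by
    have := ae_all_iff.2 fun p : Fin T × Fin d =>
      ae_eq_of_crossCov_eq_one (map_whiten_fst h.isUnit_left hmem.1)
        (map_whiten_snd h.isUnit_right hmem.2.1) (hc p.1 p.2 (hs _ _))
    filter_upwards [this] with z hz
    ext p
    exact hz p
  rw [← show (π : Measure (Path T d × Path T d)).fst = gaussian a (L * L.transpose) from hmem.1,
    Measure.fst, Measure.map_map (by fun_prop) measurable_fst]
  conv_lhs => rw [← Measure.map_id (μ := (π : Measure (Path T d × Path T d)))]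
  refine Measure.map_congr ?_
  filter_upwards [hae] with z hz
  rw [Function.comp_apply, hz, colour_whiten h.isUnit_right]
  rfl

theorem AreDiagonalizingFactors.isUniqueOptimizer_zero_iff
    (h : AreDiagonalizingFactors L M s) (a b : Path T d)
    {D : Fin T → Matrix (Fin d) (Fin d) ℝ}
    (hD : ∀ t, IsContraction (D t) ∧ ∀ i, s t i ≠ 0 → D t i i = 1) :
    IsUniqueOptimizer 0 (gaussian a (L * L.transpose)) (gaussian b (M * M.transpose))
      (gaussianCoupling a b L M D) ↔ ∀ t i, s t i ≠ 0 := by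
  have hopt := h.isOptimizer_zero_gaussianCoupling a b hD
  constructor
  · rintro ⟨-, huniq⟩ t i hti
    -- A diagonal competitor, whose correlation at `(t, i)` is `1` or `-1`, but not `D t i i`.
    let c : Fin T → Fin d → ℝ := fun u j => if s u j ≠ 0 then 1 else if D u j j = 1 then -1 else 1
    have hc : ∀ u, IsContraction (Matrix.diagonal (c u)) ∧
        ∀ j, s u j ≠ 0 → Matrix.diagonal (c u) j j = 1 := by
      refine fun u => ⟨isContraction_diagonal fun j => ?_, fun j hj => ?_⟩
      · simp only [c]; split_ifs <;> simp
      · rw [Matrix.diagonal_apply_eq]; exact if_pos hj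
    have h1 := huniq _ (h.isOptimizer_zero_gaussianCoupling a b hc)
    have h2 := crossCov_gaussianCoupling (a := a) (b := b) h.isUnit_left h.isUnit_right
      fun u => (hc u).1
    rw [h1, crossCov_gaussianCoupling h.isUnit_left h.isUnit_right fun u => (hD u).1] at h2
    have h3 : D t i i = c t i := by
      have := congrFun (congrFun h2 (t, i)) (t, i)
      simpa [blockDiag] using this
    simp only [c, hti, ne_eq, not_true_eq_false, if_false] at h3
    split_ifs at h3 with h4
    · rw [h4] at h3; norm_num at h3
    · exact h4 h3
  · exact fun hs => ⟨hopt, fun ρ hρ => Subtype.ext ((h.eq_map_of_isOptimizer_zero hs hρ).trans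
      (h.eq_map_of_isOptimizer_zero hs hopt).symm)⟩

/-- A bi-causal Gaussian coupling is determined by the diagonal blocks of its cross covariance. -/
theorem AreDiagonalizingFactors.eq_gaussianCoupling (h : AreDiagonalizingFactors L M s)
    {π : ProbabilityMeasure (Path T d × Path T d)}
    (hG : IsGaussian (π : Measure (Path T d × Path T d)))
    (hπ : π ∈ bicausalCouplings (gaussian a (L * L.transpose)) (gaussian b (M * M.transpose))) :
    (∀ t, IsContraction (block (crossCov L M a b (π : Measure (Path T d × Path T d))) t t)) ∧
      π = gaussianCoupling a b L M fun t =>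
        block (crossCov L M a b (π : Measure (Path T d × Path T d))) t t := by
  have hu := map_whiten_fst h.isUnit_left hπ.1
  have hv := map_whiten_snd h.isUnit_right hπ.2.1
  have hP := isContraction_crossCov hu hv
  have hB (p q : Fin T × Fin d) : crossCov L M a b (π : Measure (Path T d × Path T d)) p q
      = blockDiag (fun t => block (crossCov L M a b
        (π : Measure (Path T d × Path T d))) t t) p q := by
    by_cases hpq : p.1 = q.1
    · obtain ⟨t, i⟩ := p
      obtain ⟨u, j⟩ := q
      obtain rfl : t = u := hpq
      simp [blockDiag, block]
    · rw [crossCov_eq_zero_of_ne h.lower_left h.isUnit_left h.lower_right h.isUnit_right hπ hpq]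
      simp [blockDiag, hpq]
  have hmap : (π : Measure (Path T d × Path T d)).map (whitenPair L M a b)
      = multivariateGaussian 0 (pairCov (blockDiag fun t => block (crossCov L M a b
        (π : Measure (Path T d × Path T d))) t t)) := by
    refine map_eq_multivariateGaussian (hasGaussianLaw_whitenPair L M a b _)
      (posSemidef_pairCov hP) ?_ ?_
    · rintro (p | p)
      · exact integral_apply_of_map_eq hu p
      · exact integral_apply_of_map_eq hv p
    · rintro (p | p) (q | q)
      · exact covariance_apply_of_map_eq hu Matrix.PosSemidef.one p q
      · exact hB p q
      · exact (covariance_comm _ _).trans (hB q p)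
      · exact covariance_apply_of_map_eq hv Matrix.PosSemidef.one p q
  have hkey : (π : Measure (Path T d × Path T d)) = (gaussianCoupling a b L M fun t =>
      block (crossCov L M a b (π : Measure (Path T d × Path T d))) t t :
        Measure (Path T d × Path T d)) := by
    rw [gaussianCoupling_eq_map_colourPair a b hP, ← hmap,
      map_colourPair_map_whitenPair a b h.isUnit_left h.isUnit_right]
  exact ⟨hP, Subtype.ext hkey⟩

end Unregularized

/-! ### Reduction to diagonal blocks -/

section Reduction

variable {T d : ℕ} {A L M : BigMatrix T d}

theorem IsCholesky.timeLower (h : IsCholesky A L) : TimeLower L :=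
  fun p q hpq => h.lower p.1 q.1 p.2 q.2 (Or.inl hpq)

theorem IsCholesky.isUnit_det (h : IsCholesky A L) (hA : A.PosDef) : IsUnit L.det := by
  have h1 := hA.det_pos
  rw [h.eq_mul_transpose, Matrix.det_mul] at h1
  exact (left_ne_zero_of_mul h1.ne').isUnit

variable {U V : Fin T → Matrix (Fin d) (Fin d) ℝ}

theorem mul_blockDiag_mul_transpose (L : BigMatrix T d)
    (hV : ∀ t, V t ∈ Matrix.orthogonalGroup (Fin d) ℝ) :
    L * blockDiag V * (L * blockDiag V).transpose = L * L.transpose := by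
  rw [Matrix.transpose_mul, ← Matrix.mul_assoc, Matrix.mul_assoc L, blockDiag_transpose,
    blockDiag_mul]
  simp_rw [fun t => (Matrix.mem_orthogonalGroup_iff (Fin d) ℝ).1 (hV t)]
  rw [blockDiag_one, Matrix.mul_one]

theorem isUnit_det_mul_blockDiag (hL : IsUnit L.det)
    (hV : ∀ t, V t ∈ Matrix.orthogonalGroup (Fin d) ℝ) : IsUnit (L * blockDiag V).det := by
  have h1 := congrArg Matrix.det (mul_blockDiag_mul_transpose L hV)
  rw [Matrix.det_mul (L * blockDiag V), Matrix.det_mul L L.transpose, Matrix.det_transpose,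
    Matrix.det_transpose] at h1
  refine (left_ne_zero_of_mul (h1.trans_ne ?_)).isUnit
  exact mul_ne_zero hL.ne_zero hL.ne_zero

/-- Replacing the factors `L`, `M` by `L V`, `M U` amounts to conjugating the blocks. -/
theorem gaussianCoupling_mul_blockDiag (a b : Path T d)
    (hU : ∀ t, U t ∈ Matrix.orthogonalGroup (Fin d) ℝ)
    (hV : ∀ t, V t ∈ Matrix.orthogonalGroup (Fin d) ℝ) (D : Fin T → Matrix (Fin d) (Fin d) ℝ) :
    gaussianCoupling a b (L * blockDiag V) (M * blockDiag U) D
      = gaussianCoupling a b L M fun t => V t * D t * (U t).transpose := by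
  have h1 : L * blockDiag V * blockDiag D * (M * blockDiag U).transpose
      = L * blockDiag (fun t => V t * D t * (U t).transpose) * M.transpose := by
    rw [← blockDiag_mul, ← blockDiag_mul, ← blockDiag_transpose, Matrix.transpose_mul]
    simp only [Matrix.mul_assoc]
  have h2 : M * blockDiag U * (blockDiag D).transpose * (L * blockDiag V).transpose
      = M * (blockDiag fun t => V t * D t * (U t).transpose).transpose * L.transpose := by
    have := congrArg Matrix.transpose h1
    simpa only [Matrix.transpose_mul, Matrix.transpose_transpose, Matrix.mul_assoc] using this
  refine Subtype.ext ?_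
  simp only [gaussianCoupling]
  rw [mul_blockDiag_mul_transpose L hV, mul_blockDiag_mul_transpose M hU, h1, h2]

theorem areDiagonalizingFactors_mul_blockDiag {s : Fin T → Fin d → ℝ} (hL : TimeLower L)
    (hM : TimeLower M) (hLdet : IsUnit L.det) (hMdet : IsUnit M.det)
    (hsvd : ∀ t, IsSVD (block (M.transpose * L) t t) (U t) (s t) (V t)) :
    AreDiagonalizingFactors (L * blockDiag V) (M * blockDiag U) s where
  lower_left := hL.mul_blockDiag V
  lower_right := hM.mul_blockDiag U
  isUnit_left := isUnit_det_mul_blockDiag hLdet fun t => (hsvd t).right_orthogonal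
  isUnit_right := isUnit_det_mul_blockDiag hMdet fun t => (hsvd t).left_orthogonal
  nonneg t := (hsvd t).nonneg
  diag t i j := by
    have h1 : (M * blockDiag U).transpose * (L * blockDiag V)
        = (blockDiag U).transpose * (M.transpose * L) * blockDiag V := by
      rw [Matrix.transpose_mul]
      simp only [Matrix.mul_assoc]
    have h2 (N : BigMatrix T d) : block ((blockDiag U).transpose * N * blockDiag V) t t
        = (U t).transpose * block N t t * V t := by
      ext i j
      simp only [block, blockDiag, Matrix.of_apply, Matrix.mul_apply, Matrix.transpose_apply,
        Fintype.sum_prod_type, Finset.sum_mul, ite_mul, mul_ite, zero_mul, mul_zero]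
      simp
    have h3 := (Matrix.mem_orthogonalGroup_iff' (Fin d) ℝ).1 (hsvd t).left_orthogonal
    have h4 := (Matrix.mem_orthogonalGroup_iff' (Fin d) ℝ).1 (hsvd t).right_orthogonal
    have h5 : block ((M * blockDiag U).transpose * (L * blockDiag V)) t t
        = Matrix.diagonal (s t) := by
      rw [h1, h2, (hsvd t).eq_mul, Matrix.mul_assoc, Matrix.mul_assoc (U t * _), h4,
        Matrix.mul_one, ← Matrix.mul_assoc, h3, Matrix.one_mul]
    exact congrFun (congrFun h5 i) j

theorem isUnit_blockDiag_diagonal (s : Fin T → Fin d → ℝ) :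
    IsUnit (blockDiag fun t => Matrix.diagonal (s t)) ↔ ∀ t i, s t i ≠ 0 := by
  have h1 : (blockDiag fun t => Matrix.diagonal (s t))
      = Matrix.diagonal fun p : Fin T × Fin d => s p.1 p.2 := by
    ext p q
    by_cases h : p.1 = q.1
    · by_cases h' : p.2 = q.2
      · obtain rfl : p = q := Prod.ext h h'
        simp [blockDiag]
      · simp [blockDiag, h', Prod.ext_iff]
    · simp [blockDiag, h, Prod.ext_iff]
  rw [h1, Matrix.isUnit_diagonal, Pi.isUnit_iff]
  simp [isUnit_iff_ne_zero, Prod.forall]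

end Reduction

end AdaptedOT

theorem theorem2p4 (T d : ℕ) (a b : AdaptedOT.Path T d) (A B L M : AdaptedOT.BigMatrix T d)
    (hA : A.PosDef) (hB : B.PosDef)
    (hL : AdaptedOT.IsCholesky A L) (hM : AdaptedOT.IsCholesky B M)
    (U V : Fin T → Matrix (Fin d) (Fin d) ℝ) (s : Fin T → Fin d → ℝ)
    (hsvd : ∀ t, AdaptedOT.IsSVD (AdaptedOT.block (M.transpose * L) t t) (U t) (s t) (V t)) :
    (∀ lam : ℝ, 0 < lam →
      AdaptedOT.IsUniqueOptimizer lam (AdaptedOT.gaussian a A) (AdaptedOT.gaussian b B)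
        (AdaptedOT.gaussianCoupling a b L M fun t =>
          V t * Matrix.diagonal (fun i => AdaptedOT.shrink lam (s t i)) * (U t).transpose)) ∧
    (∀ D : Fin T → Matrix (Fin d) (Fin d) ℝ,
      (∀ t, AdaptedOT.IsContraction (D t) ∧ ∀ i, s t i ≠ 0 → D t i i = 1) →
        AdaptedOT.IsOptimizer 0 (AdaptedOT.gaussian a A) (AdaptedOT.gaussian b B)
          (AdaptedOT.gaussianCoupling a b L M fun t => V t * D t * (U t).transpose) ∧
        (AdaptedOT.IsUniqueOptimizer 0 (AdaptedOT.gaussian a A) (AdaptedOT.gaussian b B)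
            (AdaptedOT.gaussianCoupling a b L M fun t => V t * D t * (U t).transpose) ↔
          IsUnit (AdaptedOT.blockDiag fun t => Matrix.diagonal (s t)))) ∧
    (∀ π : MeasureTheory.ProbabilityMeasure (AdaptedOT.Path T d × AdaptedOT.Path T d),
      ProbabilityTheory.IsGaussian
          (π : MeasureTheory.Measure (AdaptedOT.Path T d × AdaptedOT.Path T d)) →
        AdaptedOT.IsOptimizer 0 (AdaptedOT.gaussian a A) (AdaptedOT.gaussian b B) π →
          ∃ D : Fin T → Matrix (Fin d) (Fin d) ℝ,
            (∀ t, AdaptedOT.IsContraction (D t) ∧ ∀ i, s t i ≠ 0 → D t i i = 1) ∧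
            π = AdaptedOT.gaussianCoupling a b L M fun t =>
              V t * D t * (U t).transpose) := by
  have h := AdaptedOT.areDiagonalizingFactors_mul_blockDiag hL.timeLower hM.timeLower
    (hL.isUnit_det hA) (hM.isUnit_det hB) hsvd
  have hU t := (hsvd t).left_orthogonal
  have hV t := (hsvd t).right_orthogonal
  rw [hL.eq_mul_transpose, hM.eq_mul_transpose, ← AdaptedOT.mul_blockDiag_mul_transpose L hV,
    ← AdaptedOT.mul_blockDiag_mul_transpose M hU, AdaptedOT.isUnit_blockDiag_diagonal]
  simp only [← AdaptedOT.gaussianCoupling_mul_blockDiag a b hU hV]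
  refine ⟨fun lam hlam => h.isUniqueOptimizer hlam a b, fun D hD =>
    ⟨h.isOptimizer_zero_gaussianCoupling a b hD, h.isUniqueOptimizer_zero_iff a b hD⟩,
    fun π hG hπ => ?_⟩
  obtain ⟨hmem, hc⟩ := (h.isOptimizer_zero_iff a b π).1 hπ
  obtain ⟨hP, heq⟩ := h.eq_gaussianCoupling hG hmem
  exact ⟨_, fun t => ⟨hP t, fun i hti => hc t i hti⟩, heq⟩
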